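/- **Setting.** Let $1<p<\infty$ and let $L_1,L_2,L_3$ satisfy $0<L_3<\min\{L_1,L_2\}$; put $I_j=(0,L_j)$. Let $H$ be the set of triples $\boldsymbol\theta=(\theta^1,\theta^2,\theta^3)$, $\theta^j\in W^{1,p}(I_j)$, with $$\int_{I_1}(\cos\theta^1,\sin\theta^1)\,ds=\int_{I_2}(\cos\theta^2,\sin\theta^2)\,ds=\int_{I_3}(\cos\theta^3,\sin\theta^3)\,ds,\qquad(\ast)$$ and let $D(\boldsymbol\theta)=\frac1p\sum_{j=1}^3\int_{I_j}|\partial_s\theta^j|^p\,ds$. For $\boldsymbol\theta_0\in H$ and $T>0$, a *weak solution on $[0,T]$ with initial datum $\boldsymbol\theta_0$* consists of functions $\theta^j\in L^\infty(0,T;W^{1,p}(I_j))\cap H^1(0,T;L^2(I_j))$, $j=1,2,3$ (identified with their representatives that are continuous on $[0,T]\times\bar I_j$), with $\theta^j(\cdot,0)=\theta^j_0$, and Lagrange multipliers $\vec\lambda=(\lambda^1,\lambda^2)$, $\vec\mu=(\mu^1,\mu^2)\in L^2(0,T;\mathbb R^2)$, such that, with $\vec\kappa_1=-(\vec\lambda-\vec\mu)$,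 $\vec\kappa_2=\vec\lambda$, $\vec\kappa_3=-\vec\mu$: (i) for all $\varphi^j\in L^\infty(0,T;W^{1,p}(I_j))$, $j=1,2,3$, $$\sum_{j=1}^3\int_0^T\!\!\int_{I_j}\Big(\partial_t\theta^j\varphi^j+|\theta^j_s|^{p-2}\theta^j_s\,\varphi^j_s+\kappa_j^1\sin\theta^j\,\varphi^j-\kappa_j^2\cos\theta^j\,\varphi^j\Big)ds\,dt=0;$$ (ii) $|\theta^j_s|^{p-2}\theta^j_s\in L^\infty(0,T;L^{p/(p-1)}(I_j))\cap L^2(0,T;H^1(I_j))$, the equation $(|\theta^j_s|^{p-2}\theta^j_s)_s=\theta^j_t+\kappa_j^1\sin\theta^j-\kappa_j^2\cos\theta^j$ holds a.e. in $(0,T)\times I_j$, and $\theta^j_s=0$ at both end points of $I_j$ for a.e. $t$; (iii) $(\ast)$ holds for $\boldsymbol\theta(\cdot,t)$ for every $t\in[0,T]$. Put $$A^j=\begin{pmatrix}\int_{I_j}\sin^2\theta^j\,ds&-\int_{I_j}\sin\theta^j\cos\theta^j\,ds\\-\int_{I_j}\sin\theta^j\cos\theta^j\,ds&\int_{I_j}\cos^2\theta^j\,ds\end{pmatrix},\qquad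 G^j=\int_{I_j}|\theta^j_s|^p(\cos\theta^j,\sin\theta^j)\,ds.$$ **Proposition.** There is a constant $C=C(D(\boldsymbol\theta_0))$, depending otherwise only on $p,L_1,L_2,L_3$, such that for every $\boldsymbol\theta_0\in H$, every $T>0$ and every weak solution $(\boldsymbol\theta,\vec\lambda,\vec\mu)$ on $[0,T]$ with initial datum $\boldsymbol\theta_0$, for a.e. $t\in(0,T)$, $$\vec\lambda\cdot A^2+\vec\mu\cdot A^3=G^3-G^2,\qquad-\vec\lambda\cdot(A^2+A^1)+\vec\mu\cdot A^1=G^2-G^1$$ (row vectors times matrices), and $$\|\vec\lambda\|_{L^\infty(0,T)}+\|\vec\mu\|_{L^\infty(0,T)}\le C(D(\boldsymbol\theta_0)).$$ In particular the bound does not depend on $T$. (A dependence of $C$ on the oscillations of $\theta^1,\theta^2$ need not be listed: because of $L_3<\min\{L_1,L_2\}$ and $(\ast)$, these are bounded below by positive constants depending only on $L_1,L_2,L_3$.) -/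

import Mathlib

namespace ThetaNetwork

open MeasureTheory
open scoped ContDiff NNReal ENNReal Matrix

noncomputable section

/-- Lebesgue measure on the open interval `(0, b)`. -/
abbrev leb (b : ℝ) : Measure ℝ := volume.restrict (Set.Ioo 0 b)

/-- Test functions on `(0, b)`: the elements of `C_c^∞(0, b)`. -/
def IsTest (b : ℝ) (φ : ℝ → ℝ) : Prop :=
  ContDiff ℝ ∞ φ ∧ HasCompactSupport φ ∧ tsupport φ ⊆ Set.Ioo 0 b

/-- `g` is the weak derivative of `f` on `(0, b)`; it is used only for `f`, `g` that are
integrable on `(0, b)`. -/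
def HasWeakDeriv (b : ℝ) (f g : ℝ → ℝ) : Prop :=
  ∀ φ : ℝ → ℝ, IsTest b φ → ∫ s, f s * deriv φ s ∂(leb b) = -∫ s, g s * φ s ∂(leb b)

/-- `f ∈ W^{1,p}(0, b)` with weak derivative `f'`. -/
def MemW1p (p b : ℝ) (f f' : ℝ → ℝ) : Prop :=
  MemLp f (ENNReal.ofReal p) (leb b) ∧ MemLp f' (ENNReal.ofReal p) (leb b) ∧ HasWeakDeriv b f f'

/-! Functions `f` of time and arc length are written `f t s`, with `t ∈ (0, T)`, `s ∈ (0, b)`. -/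

/-- `f ∈ L^∞(0, T; L^r(0, b))`. -/
def MemLinftyLp (r : ℝ) (T b : ℝ) (f : ℝ → ℝ → ℝ) : Prop :=
  AEStronglyMeasurable (Function.uncurry f) ((leb T).prod (leb b)) ∧
    ∃ M : ℝ≥0, ∀ᵐ t ∂(leb T), eLpNorm (f t) (ENNReal.ofReal r) (leb b) ≤ M

/-- `f ∈ L^∞(0, T; W^{1,p}(0, b))` with weak arc length derivative `fs`. -/
def MemLinftyW1p (p T b : ℝ) (f fs : ℝ → ℝ → ℝ) : Prop :=
  MemLinftyLp p T b f ∧ MemLinftyLp p T b fs ∧ ∀ᵐ t ∂(leb T), HasWeakDeriv b (f t) (fs t)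

/-- `f ∈ L^2(0, T; L^2(0, b))`. -/
def MemL2L2 (T b : ℝ) (f : ℝ → ℝ → ℝ) : Prop :=
  MemLp (Function.uncurry f) 2 ((leb T).prod (leb b))

/-- `f ∈ L^2(0, T; H^1(0, b))` with weak arc length derivative `fs`. -/
def MemL2H1 (T b : ℝ) (f fs : ℝ → ℝ → ℝ) : Prop :=
  MemL2L2 T b f ∧ MemL2L2 T b fs ∧ ∀ᵐ t ∂(leb T), HasWeakDeriv b (f t) (fs t)

/-- `f ∈ H^1(0, T; L^2(0, b))` with weak time derivative `ft`: the identity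
`∫ f η' dt = - ∫ ft η dt` holds in `L^2(0, b)` for every `η ∈ C_c^∞(0, T)`. -/
def MemH1L2 (T b : ℝ) (f ft : ℝ → ℝ → ℝ) : Prop :=
  MemL2L2 T b f ∧ MemL2L2 T b ft ∧
    ∀ η : ℝ → ℝ, IsTest T η →
      ∀ᵐ s ∂(leb b), ∫ t, f t s * deriv η t ∂(leb T) = -∫ t, ft t s * η t ∂(leb T)

/-- The closing constraint: the three curves of lengths `L j` with tangent angles `θ j`, issuing
from the origin, have the same end point. -/
def Concurrent (L : Fin 3 → ℝ) (θ : Fin 3 → ℝ → ℝ) : Prop :=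
  ∀ i j : Fin 3,
    ∫ s, Real.cos (θ i s) ∂(leb (L i)) = ∫ s, Real.cos (θ j s) ∂(leb (L j)) ∧
    ∫ s, Real.sin (θ i s) ∂(leb (L i)) = ∫ s, Real.sin (θ j s) ∂(leb (L j))

/-- `θ` belongs to the set `H` of admissible angle triples, with weak derivatives `θ'`. -/
def MemH (p : ℝ) (L : Fin 3 → ℝ) (θ θ' : Fin 3 → ℝ → ℝ) : Prop :=
  (∀ j, MemW1p p (L j) (θ j) (θ' j)) ∧ Concurrent L θ

/-- The energy `D(θ) = (1/p) ∑ⱼ ∫ |∂ₛ θʲ|^p ds`, in terms of the weak derivatives `θ'`. -/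
def energy (p : ℝ) (L : Fin 3 → ℝ) (θ' : Fin 3 → ℝ → ℝ) : ℝ :=
  1 / p * ∑ j, ∫ s, |θ' j s| ^ p ∂(leb (L j))

/-- `|x|^{p-2} x` (equal to `0` at `x = 0`). -/
def pflux (p x : ℝ) : ℝ := |x| ^ (p - 2) * x

/-- The vectors `-(λ - μ)`, `λ`, `-μ` by which the multipliers act on the three curves. -/
def coeff (lam mu : EuclideanSpace ℝ (Fin 2)) : Fin 3 → EuclideanSpace ℝ (Fin 2) :=
  ![-(lam - mu), lam, -mu]

/-- The matrix `A(θ)` of a curve of length `b` with tangent angle `θ`. -/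
def matA (b : ℝ) (θ : ℝ → ℝ) : Matrix (Fin 2) (Fin 2) ℝ :=
  !![∫ s, Real.sin (θ s) ^ 2 ∂(leb b), -∫ s, Real.sin (θ s) * Real.cos (θ s) ∂(leb b);
     -∫ s, Real.sin (θ s) * Real.cos (θ s) ∂(leb b), ∫ s, Real.cos (θ s) ^ 2 ∂(leb b)]

/-- The vector `G(θ) = ∫ |∂ₛθ|^p (cos θ, sin θ) ds`, with `θ'` the weak derivative of `θ`. -/
def vecG (p b : ℝ) (θ θ' : ℝ → ℝ) : Fin 2 → ℝ :=
  ![∫ s, |θ' s| ^ p * Real.cos (θ s) ∂(leb b), ∫ s, |θ' s| ^ p * Real.sin (θ s) ∂(leb b)]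

/-- `θ` (with weak derivatives `θs` in arc length and `θt` in time), `lam` and `mu` form a weak
solution on `[0, T]`, with Lagrange multipliers, of the `L²`-gradient flow of the `p`-elastic
energy of theta-networks with initial datum `θ₀`. -/
structure IsWeakSolution (p : ℝ) (L : Fin 3 → ℝ) (T : ℝ) (θ₀ : Fin 3 → ℝ → ℝ)
    (θ θs θt : Fin 3 → ℝ → ℝ → ℝ) (lam mu : ℝ → EuclideanSpace ℝ (Fin 2)) : Prop where
  /-- `θʲ ∈ L^∞(0, T; W^{1,p})` -/
  memLinftyW1p : ∀ j, MemLinftyW1p p T (L j) (θ j) (θs j)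
  /-- `θʲ ∈ H^1(0, T; L^2)` -/
  memH1L2 : ∀ j, MemH1L2 T (L j) (θ j) (θt j)
  /-- `θʲ` is the continuous representative of its class (one exists by the two previous
  conditions), so that its values at each time make sense. -/
  continuousOn : ∀ j,
    ContinuousOn (Function.uncurry (θ j)) (Set.Icc 0 T ×ˢ Set.Icc 0 (L j))
  /-- the initial condition -/
  initial : ∀ j, ∀ᵐ s ∂(leb (L j)), θ j 0 s = θ₀ j s
  memL2_lam : MemLp lam 2 (leb T)
  memL2_mu : MemLp mu 2 (leb T)
  /-- the weak formulation -/
  weak : ∀ φ φs : Fin 3 → ℝ → ℝ → ℝ, (∀ j, MemLinftyW1p p T (L j) (φ j) (φs j)) →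
    ∑ j, ((∫ t, ∫ s, θt j t s * φ j t s ∂(leb (L j)) ∂(leb T))
      + (∫ t, ∫ s, pflux p (θs j t s) * φs j t s ∂(leb (L j)) ∂(leb T))
      + (∫ t, coeff (lam t) (mu t) j 0
          * ∫ s, Real.sin (θ j t s) * φ j t s ∂(leb (L j)) ∂(leb T))
      - (∫ t, coeff (lam t) (mu t) j 1
          * ∫ s, Real.cos (θ j t s) * φ j t s ∂(leb (L j)) ∂(leb T))) = 0
  /-- the fluxes belong to `L^∞(0, T; L^{p/(p-1)})` -/
  flux_bounded : ∀ j, MemLinftyLp (p / (p - 1)) T (L j) (fun t s => pflux p (θs j t s))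
  /-- the fluxes belong to `L^2(0, T; H^1)` and the differential equations hold a.e. -/
  flux_eq : ∀ j, ∃ w : ℝ → ℝ → ℝ, MemL2H1 T (L j) (fun t s => pflux p (θs j t s)) w ∧
    ∀ᵐ t ∂(leb T), ∀ᵐ s ∂(leb (L j)),
      w t s = θt j t s + coeff (lam t) (mu t) j 0 * Real.sin (θ j t s)
        - coeff (lam t) (mu t) j 1 * Real.cos (θ j t s)
  /-- the boundary conditions: at a.e. time the continuous representative of `∂ₛθʲ` vanishes
  at both end points -/
  boundary : ∀ j, ∀ᵐ t ∂(leb T), ∃ u : ℝ → ℝ, ContinuousOn u (Set.Icc 0 (L j)) ∧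
    (∀ᵐ s ∂(leb (L j)), u s = θs j t s) ∧ u 0 = 0 ∧ u (L j) = 0
  /-- the constraint at all times -/
  concurrent : ∀ t ∈ Set.Icc 0 T, Concurrent L (fun j => θ j t)

end

end ThetaNetwork

/-! At almost every time the flux equation can be tested with `sin θʲ` and `cos θʲ`. The flux
vanishes at both end points, so no boundary terms arise, and the result is `Gʲ + κⱼ Aʲ = Vʲ` with
`Vʲ = (-∫ θʲₜ sin θʲ, ∫ θʲₜ cos θʲ)`. This `Vʲ` is the velocity of the end point of the `j`-th
curve. Differentiating the constraint in time shows that it is the same vector `V` for all three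
curves, and differences of the three identities give the linear system.

For the bound, pair the `j`-th identity with `κⱼ` and sum. Since `∑ κⱼ = 0`, the unknown `V` drops
out and `∑ κⱼ Aʲ · κⱼ = -∑ Gʲ · κⱼ`. The form `ξ Aʲ · ξ = ∫ (ξ₀ sin θʲ - ξ₁ cos θʲ)²` measures how
far the tangent turns away from the direction `ξ`. The two long curves span a chord no longer than
the shortest curve, so they cannot be nearly straight. Together with the equicontinuity supplied by
the energy this makes their forms coercive (`exists_coercive`). The third form is only nonnegative,
which suffices because two of the `κⱼ` determine the third (`sum_abs_le_of_coercive`). The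
right-hand side is controlled by `|Gʲ| ≤ ∫ |θʲₛ|^p`.

What remains is that the energy stays below its initial value (`ae_sum_integral_rpow_le`). Formally
its derivative is `-∑ ∫ |θʲₜ|²`, the multiplier terms cancelling by the differentiated constraint,
but `θₛ` has no time derivative to justify the chain rule. Convexity of `|x|^p` replaces it: the
increment of the energy over a backward time step is at most `-p ∑ ∫ wʲ (θʲ(t) - θʲ(t-h))`, with
`wʲ` the derivative of the flux. Integrating in time, dividing by `h` and letting `h → 0` needs only
weak `L²` convergence of the difference quotients of `θʲ` (`tendsto_integral_mul_diffQuot`). -/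

namespace ThetaNetwork

open MeasureTheory Set Filter Topology
open scoped ContDiff NNReal ENNReal Matrix

noncomputable section

/-! ### Calculus of indefinite integrals -/

/-- `F` is an indefinite integral of `f` on `[0, b]`. -/
structure IsPrimitive (b : ℝ) (F f : ℝ → ℝ) : Prop where
  intervalIntegrable : IntervalIntegrable f volume 0 b
  eq_add_integral : ∀ x ∈ Icc 0 b, F x = F 0 + ∫ y in (0 : ℝ)..x, f y

theorem integral_leb {b : ℝ} (hb : 0 ≤ b) (f : ℝ → ℝ) :
    ∫ s, f s ∂(leb b) = ∫ s in (0 : ℝ)..b, f s := by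
  rw [intervalIntegral.integral_of_le hb, integral_Ioc_eq_integral_Ioo]

theorem intervalIntegrable_iff_leb {b : ℝ} (hb : 0 ≤ b) {f : ℝ → ℝ} :
    IntervalIntegrable f volume 0 b ↔ Integrable f (leb b) :=
  intervalIntegrable_iff_integrableOn_Ioo_of_le hb

theorem ae_leb_iff {b : ℝ} {P : ℝ → Prop} :
    (∀ᵐ s ∂(leb b), P s) ↔ ∀ᵐ s, s ∈ Ioo 0 b → P s :=
  ae_restrict_iff' measurableSet_Ioo

theorem ae_mem_Ioo_leb (b : ℝ) : ∀ᵐ s ∂(leb b), s ∈ Ioo 0 b :=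
  ae_restrict_mem measurableSet_Ioo

/-- Post-composition with a Lipschitz function preserves absolute continuity. -/
theorem _root_.LipschitzWith.comp_absolutelyContinuousOnInterval {K : ℝ≥0} {g F : ℝ → ℝ} {a b : ℝ}
    (hg : LipschitzWith K g) (hF : AbsolutelyContinuousOnInterval F a b) :
    AbsolutelyContinuousOnInterval (fun x => g (F x)) a b := by
  rw [absolutelyContinuousOnInterval_iff] at hF ⊢
  intro ε hε
  -- Dividing by `K + 1` instead of `K` covers `K = 0`.
  obtain ⟨δ, hδ, h⟩ := hF (ε / (K + 1)) (by positivity)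
  refine ⟨δ, hδ, fun E hE hE' => ?_⟩
  calc
    _ ≤ ∑ i ∈ Finset.range E.1, K * dist (F (E.2 i).1) (F (E.2 i).2) :=
      Finset.sum_le_sum fun i _ => hg.dist_le_mul _ _
    _ = K * ∑ i ∈ Finset.range E.1, dist (F (E.2 i).1) (F (E.2 i).2) := by
      rw [Finset.mul_sum]
    _ ≤ K * (ε / (K + 1)) := by gcongr; exact (h E hE hE').le
    _ < (K + 1) * (ε / (K + 1)) := by gcongr; linarith
    _ = ε := by field

namespace IsPrimitive

variable {b : ℝ} {F f G g : ℝ → ℝ}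

theorem absolutelyContinuous (hb : 0 ≤ b) (h : IsPrimitive b F f) :
    AbsolutelyContinuousOnInterval F 0 b := by
  have h1 := h.intervalIntegrable.absolutelyContinuousOnInterval_intervalIntegral
    (c := 0) (by simp)
  have h2 : AbsolutelyContinuousOnInterval (fun _ : ℝ => F 0) 0 b :=
    ((LipschitzWith.const (F 0)).lipschitzOnWith (s := uIcc 0 b)).absolutelyContinuousOnInterval
  have h3 := h2.add h1
  rw [absolutelyContinuousOnInterval_iff] at h3 ⊢
  intro ε hε
  obtain ⟨δ, hδ, h4⟩ := h3 ε hε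
  refine ⟨δ, hδ, fun E hE hE' => lt_of_eq_of_lt (Finset.sum_congr rfl fun i hi => ?_) (h4 E hE hE')⟩
  have hm := hE.1 i hi
  rw [uIcc_of_le hb] at hm
  rw [h.eq_add_integral _ hm.1, h.eq_add_integral _ hm.2]
  rfl

theorem continuousOn (hb : 0 ≤ b) (h : IsPrimitive b F f) : ContinuousOn F (Icc 0 b) := by
  simpa [uIcc_of_le hb] using (h.absolutelyContinuous hb).continuousOn

theorem ae_hasDerivAt (hb : 0 ≤ b) (h : IsPrimitive b F f) :
    ∀ᵐ x ∂(leb b), HasDerivAt F (f x) x := by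
  rw [ae_leb_iff]
  filter_upwards [h.intervalIntegrable.ae_hasDerivAt_integral] with x hx hxb
  rw [uIcc_of_le hb] at hx
  refine ((hx (Ioo_subset_Icc_self hxb) 0 ⟨le_rfl, hb⟩).const_add (F 0)).congr_of_eventuallyEq ?_
  filter_upwards [Ioo_mem_nhds hxb.1 hxb.2] with y hy
  exact h.eq_add_integral y (Ioo_subset_Icc_self hy)

/-- The fundamental theorem of calculus for absolutely continuous functions. It reduces the sum,
product and chain rules below to stability of absolute continuity and pointwise differentiation
almost everywhere. -/
theorem of_absolutelyContinuous (hb : 0 ≤ b) (hF : AbsolutelyContinuousOnInterval F 0 b)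
    (hd : ∀ᵐ x ∂(leb b), HasDerivAt F (f x) x) : IsPrimitive b F f := by
  have hfd : ∀ᵐ x ∂(leb b), deriv F x = f x := hd.mono fun x hx => hx.deriv
  have hint : Integrable (deriv F) (leb b) :=
    (intervalIntegrable_iff_leb hb).1 hF.intervalIntegrable_deriv
  refine ⟨(intervalIntegrable_iff_leb hb).2 (hint.congr hfd), fun x hx => ?_⟩
  have h1 := (hF.mono (c := 0) (d := x) (by
    rw [uIcc_of_le hb, uIcc_of_le hx.1]; exact Icc_subset_Icc_right hx.2)).integral_deriv_eq_sub
  have h2 : ∫ y in (0 : ℝ)..x, deriv F y = ∫ y in (0 : ℝ)..x, f y := by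
    rw [← integral_leb hx.1, ← integral_leb hx.1]
    exact integral_congr_ae (ae_restrict_of_ae_restrict_of_subset (Ioo_subset_Ioo_right hx.2) hfd)
  linarith

theorem congr_deriv (hb : 0 ≤ b) (h : IsPrimitive b F f) (hfg : ∀ᵐ x ∂(leb b), f x = g x) :
    IsPrimitive b F g :=
  of_absolutelyContinuous hb (h.absolutelyContinuous hb)
    (by filter_upwards [h.ae_hasDerivAt hb, hfg] with x hx hx'; rwa [← hx'])

theorem sub (hb : 0 ≤ b) (hF : IsPrimitive b F f) (hG : IsPrimitive b G g) :
    IsPrimitive b (fun x => F x - G x) (fun x => f x - g x) :=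
  of_absolutelyContinuous hb ((hF.absolutelyContinuous hb).fun_sub (hG.absolutelyContinuous hb))
    (by filter_upwards [hF.ae_hasDerivAt hb, hG.ae_hasDerivAt hb] with x h1 h2; exact h1.sub h2)

theorem sin (hb : 0 ≤ b) (hF : IsPrimitive b F f) :
    IsPrimitive b (fun x => Real.sin (F x)) (fun x => Real.cos (F x) * f x) :=
  of_absolutelyContinuous hb
    (Real.lipschitzWith_sin.comp_absolutelyContinuousOnInterval (hF.absolutelyContinuous hb))
    (by filter_upwards [hF.ae_hasDerivAt hb] with x h1; exact h1.sin)

theorem cos (hb : 0 ≤ b) (hF : IsPrimitive b F f) :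
    IsPrimitive b (fun x => Real.cos (F x)) (fun x => -Real.sin (F x) * f x) :=
  of_absolutelyContinuous hb
    (Real.lipschitzWith_cos.comp_absolutelyContinuousOnInterval (hF.absolutelyContinuous hb))
    (by filter_upwards [hF.ae_hasDerivAt hb] with x h1; exact h1.cos)

theorem mul (hb : 0 ≤ b) (hF : IsPrimitive b F f) (hG : IsPrimitive b G g) :
    IsPrimitive b (fun x => F x * G x) (fun x => f x * G x + F x * g x) :=
  of_absolutelyContinuous hb ((hF.absolutelyContinuous hb).fun_mul (hG.absolutelyContinuous hb))
    (by filter_upwards [hF.ae_hasDerivAt hb, hG.ae_hasDerivAt hb] with x h1 h2; exact h1.mul h2)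

theorem integral_eq_sub (hb : 0 ≤ b) (hF : IsPrimitive b F f) :
    ∫ s, f s ∂(leb b) = F b - F 0 := by
  rw [integral_leb hb, hF.eq_add_integral b ⟨hb, le_rfl⟩]; ring

theorem integrable (hb : 0 ≤ b) (hF : IsPrimitive b F f) : Integrable f (leb b) :=
  (intervalIntegrable_iff_leb hb).1 hF.intervalIntegrable

theorem _root_.ThetaNetwork.integrable_continuousOn_mul (hb : 0 ≤ b)
    (hG : ContinuousOn G (Icc 0 b)) (hf : Integrable f (leb b)) :
    Integrable (fun s => G s * f s) (leb b) := by
  rw [← intervalIntegrable_iff_leb hb] at hf ⊢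
  exact hf.continuousOn_mul (by rwa [uIcc_of_le hb])

theorem _root_.ThetaNetwork.integrable_of_continuousOn (hG : ContinuousOn G (Icc 0 b)) :
    Integrable G (leb b) :=
  (hG.integrableOn_Icc (μ := volume)).mono_set Ioo_subset_Icc_self

theorem integral_mul_eq_neg (hb : 0 ≤ b) (hF : IsPrimitive b F f) (hG : IsPrimitive b G g)
    (h0 : F 0 * G 0 = 0) (h1 : F b * G b = 0) :
    ∫ s, F s * g s ∂(leb b) = -∫ s, f s * G s ∂(leb b) := by
  have h := (hF.mul hb hG).integral_eq_sub hb
  rw [integral_add, h0, h1] at h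
  · linarith
  · simp_rw [mul_comm (f _)]
    exact integrable_continuousOn_mul hb (hG.continuousOn hb) (hF.integrable hb)
  · exact integrable_continuousOn_mul hb (hF.continuousOn hb) (hG.integrable hb)

theorem ae_eq (hb : 0 ≤ b) (hF : IsPrimitive b F f) (hG : IsPrimitive b G g)
    (hFG : ∀ x ∈ Icc 0 b, F x = G x) : ∀ᵐ x ∂(leb b), f x = g x := by
  filter_upwards [hF.ae_hasDerivAt hb, hG.ae_hasDerivAt hb, ae_mem_Ioo_leb b] with x h1 h2 hx
  refine h1.unique (h2.congr_of_eventuallyEq ?_)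
  filter_upwards [Ioo_mem_nhds hx.1 hx.2] with y hy using hFG y (Ioo_subset_Icc_self hy)

theorem of_contDiff (hb : 0 ≤ b) {φ : ℝ → ℝ} (hφ : ContDiff ℝ ∞ φ) :
    IsPrimitive b φ (deriv φ) :=
  of_absolutelyContinuous hb (hφ.contDiffOn.of_le (by simp)).absolutelyContinuousOnInterval
    (ae_of_all _ fun x => (hφ.differentiable (by simp) x).hasDerivAt)

end IsPrimitive

/-! ### Weak derivatives in one variable -/

theorem IsTest.eq_zero_of_notMem {b : ℝ} {φ : ℝ → ℝ} (h : IsTest b φ) {x : ℝ}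
    (hx : x ∉ Ioo 0 b) : φ x = 0 :=
  image_eq_zero_of_notMem_tsupport fun h' => hx (h.2.2 h')

theorem exists_isTest_integral_eq_one {b : ℝ} (hb : 0 < b) :
    ∃ ρ, IsTest b ρ ∧ ∫ s, ρ s ∂(leb b) = 1 := by
  let B : ContDiffBump (b / 2) := ⟨b / 8, b / 4, by positivity, by linarith⟩
  have hs : tsupport (B.normed volume) ⊆ Ioo 0 b := by
    rw [B.tsupport_normed_eq, Real.closedBall_eq_Icc]
    intro x hx
    have h1 : b / 2 - b / 4 ≤ x := hx.1
    have h2 : x ≤ b / 2 + b / 4 := hx.2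
    constructor <;> linarith
  refine ⟨B.normed volume, ⟨B.contDiff_normed, B.hasCompactSupport_normed, hs⟩, ?_⟩
  rw [setIntegral_eq_integral_of_forall_compl_eq_zero, B.integral_normed]
  intro x hx
  exact image_eq_zero_of_notMem_tsupport fun h => hx (hs h)

/-- The primitive of a test function with vanishing mean is a test function. -/
theorem IsTest.primitive {b : ℝ} (hb : 0 < b) {φ : ℝ → ℝ} (h : IsTest b φ)
    (h0 : ∫ s, φ s ∂(leb b) = 0) : IsTest b (fun x => ∫ y in (0 : ℝ)..x, φ y) := by
  have hd : ∀ x, HasDerivAt (fun x => ∫ y in (0 : ℝ)..x, φ y) (φ x) x := fun x =>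
    intervalIntegral.integral_hasDerivAt_right (h.1.continuous.intervalIntegrable _ _)
      h.1.continuous.stronglyMeasurable.stronglyMeasurableAtFilter h.1.continuous.continuousAt
  have hderiv : deriv (fun x => ∫ y in (0 : ℝ)..x, φ y) = φ := funext fun x => (hd x).deriv
  obtain ⟨c, d, hcd, hc, hd', hK⟩ : ∃ c d, c ≤ d ∧ 0 < c ∧ d < b ∧ tsupport φ ⊆ Icc c d := by
    rcases (tsupport φ).eq_empty_or_nonempty with he | hne
    · exact ⟨b / 2, b / 2, le_rfl, by linarith, by linarith, by simp [he]⟩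
    · have hc := h.2.1.isCompact.sInf_mem hne
      have hd' := h.2.1.isCompact.sSup_mem hne
      have hsub : tsupport φ ⊆ Icc (sInf (tsupport φ)) (sSup (tsupport φ)) := fun x hx =>
        ⟨csInf_le h.2.1.isCompact.bddBelow hx, le_csSup h.2.1.isCompact.bddAbove hx⟩
      exact ⟨_, _, (hsub hc).2, (h.2.2 hc).1, (h.2.2 hd').2, hsub⟩
  have hzero : ∀ x, φ x ≠ 0 → x ∈ Icc c d := fun x hx => hK (subset_tsupport φ hx)
  have hi : ∀ x y, IntervalIntegrable φ volume x y := fun x y =>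
    h.1.continuous.intervalIntegrable x y
  have hsupp : tsupport (fun x => ∫ y in (0 : ℝ)..x, φ y) ⊆ Icc c d := by
    refine closure_minimal (fun x hx => ?_) isClosed_Icc
    by_contra hx'
    apply hx
    rcases lt_or_ge x c with hxc | hxc
    · have : ∫ y in (0 : ℝ)..x, φ y = ∫ y in (0 : ℝ)..x, 0 := by
        refine intervalIntegral.integral_congr fun y hy => ?_
        by_contra hy0
        have h1 := (hzero y hy0).1
        rcases mem_uIcc.1 hy with h2 | h2 <;> linarith [h2.1, h2.2]
      simp [this]
    · have hxd : d < x := lt_of_not_ge fun h' => hx' ⟨hxc, h'⟩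
      -- To the right of the support the primitive equals the total integral, which is zero.
      have h2 : ∫ y in x..b, φ y = ∫ y in x..b, 0 := by
        refine intervalIntegral.integral_congr fun y hy => ?_
        by_contra hy0
        have h1 := (hzero y hy0).2
        rcases mem_uIcc.1 hy with h2 | h2 <;> linarith [h2.1, h2.2]
      have h3 := intervalIntegral.integral_add_adjacent_intervals (hi 0 x) (hi x b)
      rw [← integral_leb hb.le, h0, h2] at h3
      simpa using h3
  refine ⟨?_, isCompact_Icc.of_isClosed_subset (isClosed_tsupport _) hsupp,
    fun x hx => ⟨hc.trans_le (hsupp hx).1, (hsupp hx).2.trans_lt hd'⟩⟩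
  rw [contDiff_infty_iff_deriv, hderiv]
  exact ⟨fun x => (hd x).differentiableAt, h.1⟩

theorem IsTest.integrable_mul {b : ℝ} {φ f : ℝ → ℝ} (h : IsTest b φ) (hb : 0 ≤ b)
    (hf : Integrable f (leb b)) : Integrable (fun s => f s * φ s) (leb b) := by
  simp_rw [mul_comm (f _)]
  exact integrable_continuousOn_mul hb h.1.continuous.continuousOn hf

/-- A continuous function on `(0, b)` with vanishing weak derivative is constant. -/
theorem eq_const_of_hasWeakDeriv_zero {b : ℝ} (hb : 0 < b) {U : ℝ → ℝ}
    (hU : ContinuousOn U (Icc 0 b))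
    (h : ∀ φ, IsTest b φ → ∫ s, U s * deriv φ s ∂(leb b) = 0) :
    ∀ x ∈ Icc 0 b, U x = U 0 := by
  obtain ⟨ρ, hρ, hρ1⟩ := exists_isTest_integral_eq_one hb
  set c := ∫ s, U s * ρ s ∂(leb b)
  have hUi : Integrable U (leb b) := integrable_of_continuousOn hU
  -- The du Bois-Reymond argument: after subtracting the multiple of `ρ` with the same mean, `ψ` is
  -- the derivative of a test function, so `U` integrates against `ψ` as the constant `c` does.
  have key : ∀ ψ, IsTest b ψ → ∫ s, ψ s * (U s - c) ∂(leb b) = 0 := by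
    intro ψ hψ
    set m := ∫ s, ψ s ∂(leb b)
    have hψi : Integrable ψ (leb b) := integrable_of_continuousOn hψ.1.continuous.continuousOn
    have hρi : Integrable ρ (leb b) := integrable_of_continuousOn hρ.1.continuous.continuousOn
    have ht : IsTest b (fun x => ψ x - m * ρ x) := by
      refine ⟨hψ.1.sub (contDiff_const.mul hρ.1), hψ.2.1.sub (hρ.2.1.mul_left), ?_⟩
      refine (tsupport_sub ψ (fun x => m * ρ x)).trans (union_subset hψ.2.2 ?_)
      exact (tsupport_mul_subset_right).trans hρ.2.2
    have hm : ∫ s, (ψ s - m * ρ s) ∂(leb b) = 0 := by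
      rw [integral_sub hψi (hρi.const_mul m), integral_const_mul, hρ1]; simp [m]
    have hφ := ht.primitive hb hm
    have hder : ∀ x, deriv (fun x => ∫ y in (0 : ℝ)..x, (ψ y - m * ρ y)) x = ψ x - m * ρ x :=
      fun x => (intervalIntegral.integral_hasDerivAt_right
        (ht.1.continuous.intervalIntegrable _ _)
        ht.1.continuous.stronglyMeasurable.stronglyMeasurableAtFilter
        ht.1.continuous.continuousAt).deriv
    have h1 := h _ hφ
    simp_rw [hder] at h1
    have h2 : ∫ s, U s * (ψ s - m * ρ s) ∂(leb b) = ∫ s, U s * ψ s ∂(leb b) - m * c := by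
      rw [← integral_const_mul, ← integral_sub (hψ.integrable_mul hb.le hUi)
        ((hρ.integrable_mul hb.le hUi).const_mul m)]
      congr 1; ext s; ring
    have h3 : ∫ s, ψ s * (U s - c) ∂(leb b) = ∫ s, U s * ψ s ∂(leb b) - c * m := by
      rw [← integral_const_mul, ← integral_sub (hψ.integrable_mul hb.le hUi) (hψi.const_mul c)]
      congr 1; ext s; ring
    rw [h3]; linarith
  have hae : ∀ᵐ s, s ∈ Ioo 0 b → U s - c = 0 := by
    refine isOpen_Ioo.ae_eq_zero_of_integral_contDiff_smul_eq_zero ?_ fun ψ h1 h2 h3 => ?_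
    · exact IntegrableOn.locallyIntegrableOn (hUi.sub (integrable_const c))
    · rw [← key ψ ⟨h1, h2, h3⟩]
      refine (setIntegral_eq_integral_of_forall_compl_eq_zero fun x hx => ?_).symm
      rw [IsTest.eq_zero_of_notMem ⟨h1, h2, h3⟩ hx, zero_smul]
  have hEq : EqOn U (fun _ => c) (Icc 0 b) := by
    have h1 : EqOn U (fun _ => c) (Ioo 0 b) := by
      refine Measure.eqOn_open_of_ae_eq (μ := volume) ?_ isOpen_Ioo
        (hU.mono Ioo_subset_Icc_self) continuousOn_const
      rw [EventuallyEq, ae_restrict_iff' measurableSet_Ioo]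
      filter_upwards [hae] with s hs hs' using sub_eq_zero.1 (hs hs')
    refine h1.of_subset_closure hU continuousOn_const Ioo_subset_Icc_self ?_
    rw [closure_Ioo hb.ne]
  intro x hx
  rw [hEq hx, hEq ⟨le_rfl, hb.le⟩]

/-- A continuous representative of a function with an integrable weak derivative is an indefinite
integral of this derivative. -/
theorem HasWeakDeriv.isPrimitive {b : ℝ} (hb : 0 < b) {F f g : ℝ → ℝ} (h : HasWeakDeriv b f g)
    (hg : Integrable g (leb b)) (hF : ContinuousOn F (Icc 0 b))
    (hFf : ∀ᵐ s ∂(leb b), F s = f s) : IsPrimitive b F g := by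
  have hgi := (intervalIntegrable_iff_leb hb.le).2 hg
  have hP : IsPrimitive b (fun x => ∫ y in (0 : ℝ)..x, g y) g := ⟨hgi, fun x _ => by simp⟩
  refine ⟨hgi, fun x hx => ?_⟩
  have hU := eq_const_of_hasWeakDeriv_zero hb (hF.sub (hP.continuousOn hb.le))
    (fun φ hφ => ?_) x hx
  · simp at hU; linarith
  have hφ0 := hφ.eq_zero_of_notMem (x := 0) (by simp)
  have hφb := hφ.eq_zero_of_notMem (x := b) (by simp)
  have hpφ := IsPrimitive.of_contDiff hb.le hφ.1
  have h1 := hP.integral_mul_eq_neg hb.le hpφ (by simp [hφ0]) (by simp [hφb])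
  have h2 := h φ hφ
  have h3 : ∫ s, F s * deriv φ s ∂(leb b) = ∫ s, f s * deriv φ s ∂(leb b) :=
    integral_congr_ae (by filter_upwards [hFf] with s hs; rw [hs])
  have hi : ∀ G : ℝ → ℝ, ContinuousOn G (Icc 0 b) →
      Integrable (fun s => G s * deriv φ s) (leb b) := fun G hG =>
    integrable_continuousOn_mul hb.le hG (hpφ.integrable hb.le)
  simp only [Pi.sub_apply, sub_mul]
  rw [integral_sub (hi F hF) (hi _ (hP.continuousOn hb.le))]
  linarith

/-! ### Weak time derivatives at almost every arc length -/

theorem continuous_integral_mul_IccExtend {T : ℝ} (hT : 0 ≤ T) {f : ℝ → ℝ}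
    (hf : Integrable f (leb T)) :
    Continuous fun a : C(Icc 0 T, ℝ) => ∫ t, f t * IccExtend hT a t ∂(leb T) := by
  have hi : ∀ a : C(Icc 0 T, ℝ), Integrable (fun t => f t * IccExtend hT a t) (leb T) :=
    fun a => by
      simp_rw [mul_comm (f _)]
      exact integrable_continuousOn_mul hT a.continuous.Icc_extend'.continuousOn hf
  refine (LipschitzWith.of_dist_le_mul (K := (∫ t, ‖f t‖ ∂(leb T)).toNNReal)
    fun a c => ?_).continuous
  rw [Real.coe_toNNReal _ (integral_nonneg fun _ => norm_nonneg _), Real.dist_eq,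
    ← integral_sub (hi a) (hi c), ← integral_mul_const, ← Real.norm_eq_abs]
  refine norm_integral_le_of_norm_le (hf.norm.mul_const _) (ae_of_all _ fun t => ?_)
  rw [← mul_sub, norm_mul]
  gcongr
  exact ContinuousMap.dist_apply_le_dist (f := a) (g := c) (projIcc 0 T hT t)

/-- A weak derivative with respect to time of an `L²`-valued function is, for almost every
`s`, a weak derivative of the function of time at `s`. -/
theorem MemH1L2.ae_hasWeakDeriv {T b : ℝ} (hT : 0 < T) {f ft : ℝ → ℝ → ℝ}
    (h : MemH1L2 T b f ft) :
    ∀ᵐ s ∂(leb b), HasWeakDeriv T (fun t => f t s) (fun t => ft t s) := by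
  obtain ⟨hf, hft, hw⟩ := h
  -- The exceptional null set of `s` depends on `η`. The pairs `(η', η)` form a separable subset of
  -- `C[0,T]²`, so countably many of them suffice. Both sides of the identity are continuous in the
  -- pair for the uniform norm, which carries it to all test functions.
  let Φ : {η : ℝ → ℝ // IsTest T η} → C(Icc 0 T, ℝ) × C(Icc 0 T, ℝ) := fun η =>
    (⟨fun t => deriv η.1 t, (η.2.1.continuous_deriv (by simp)).comp continuous_subtype_val⟩,
      ⟨fun t => η.1 t, η.2.1.continuous.comp continuous_subtype_val⟩)
  obtain ⟨D, hDc, hDd⟩ := TopologicalSpace.exists_countable_dense (range Φ)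
  have hD : ∀ᵐ s ∂(leb b), ∀ x ∈ D, ∫ t, f t s * IccExtend hT.le x.1.1 t ∂(leb T)
      = -∫ t, ft t s * IccExtend hT.le x.1.2 t ∂(leb T) := by
    refine (ae_ball_iff hDc).2 fun x _ => ?_
    obtain ⟨_, η, rfl⟩ := x
    filter_upwards [hw η.1 η.2] with s hs
    convert hs using 1
    · refine setIntegral_congr_fun measurableSet_Ioo fun t ht => ?_
      simp [Φ, IccExtend_of_mem _ _ (Ioo_subset_Icc_self ht)]
    · congr 1
      refine setIntegral_congr_fun measurableSet_Ioo fun t ht => ?_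
      simp [Φ, IccExtend_of_mem _ _ (Ioo_subset_Icc_self ht)]
  have hfi := (hf.integrable (by norm_num)).prod_left_ae
  have hfti := (hft.integrable (by norm_num)).prod_left_ae
  filter_upwards [hD, hfi, hfti] with s hs h1 h2 η hη
  have hc : IsClosed {x : range Φ | ∫ t, f t s * IccExtend hT.le x.1.1 t ∂(leb T)
      = -∫ t, ft t s * IccExtend hT.le x.1.2 t ∂(leb T)} :=
    isClosed_eq
      ((continuous_integral_mul_IccExtend hT.le h1).comp (by fun_prop))
      ((continuous_integral_mul_IccExtend hT.le h2).comp (by fun_prop)).neg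
  have hall := hc.closure_subset_iff.2 hs (hDd ⟨_, ⟨η, hη⟩, rfl⟩)
  rw [mem_ofPred_eq] at hall
  convert hall using 1
  · refine setIntegral_congr_fun measurableSet_Ioo fun t ht => ?_
    simp [Φ, IccExtend_of_mem _ _ (Ioo_subset_Icc_self ht)]
  · congr 1
    refine setIntegral_congr_fun measurableSet_Ioo fun t ht => ?_
    simp [Φ, IccExtend_of_mem _ _ (Ioo_subset_Icc_self ht)]

theorem MemH1L2.ae_isPrimitive {T b : ℝ} (hT : 0 < T) {f ft : ℝ → ℝ → ℝ}
    (h : MemH1L2 T b f ft)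
    (hc : ContinuousOn (Function.uncurry f) (Icc 0 T ×ˢ Icc 0 b)) :
    ∀ᵐ s ∂(leb b), IsPrimitive T (fun t => f t s) (fun t => ft t s) := by
  filter_upwards [h.ae_hasWeakDeriv hT, (h.2.1.integrable (by norm_num)).prod_left_ae,
    ae_mem_Ioo_leb b] with s h1 h2 hs
  refine h1.isPrimitive hT h2 ?_ (ae_of_all _ fun _ => rfl)
  exact hc.comp (f := fun t => (t, s)) (by fun_prop)
    fun t ht => ⟨ht, Ioo_subset_Icc_self hs⟩

/-! ### Difference quotients and their weak convergence in L² -/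

theorem sq_integral_le {a b : ℝ} (hab : a ≤ b) {g : ℝ → ℝ} (hg : IntervalIntegrable g volume a b)
    (hg2 : IntervalIntegrable (fun t => g t ^ 2) volume a b) :
    (∫ t in a..b, g t) ^ 2 ≤ (b - a) * ∫ t in a..b, g t ^ 2 := by
  rcases hab.eq_or_lt with rfl | hlt
  · simp
  set m := ∫ t in a..b, g t
  -- Expanding the variance of `g`, scaled to avoid division, gives the Cauchy-Schwarz inequality
  -- against a constant.
  have h1 : 0 ≤ ∫ t in a..b, ((b - a) * g t - m) ^ 2 :=
    intervalIntegral.integral_nonneg hab fun _ _ => sq_nonneg _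
  have h2 : ∫ t in a..b, ((b - a) * g t - m) ^ 2
      = (b - a) ^ 2 * (∫ t in a..b, g t ^ 2) - 2 * (b - a) * m * m + (b - a) * m ^ 2 := by
    have : ∀ t, ((b - a) * g t - m) ^ 2
        = (b - a) ^ 2 * g t ^ 2 - 2 * (b - a) * m * g t + m ^ 2 := fun t => by ring
    simp_rw [this]
    rw [intervalIntegral.integral_add ((hg2.const_mul _).sub (hg.const_mul _)) (by simp),
      intervalIntegral.integral_sub (hg2.const_mul _) (hg.const_mul _),
      intervalIntegral.integral_const_mul, intervalIntegral.integral_const_mul,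
      intervalIntegral.integral_const, smul_eq_mul]
  rw [h2] at h1
  have h3 : 0 ≤ (b - a) * ((b - a) * (∫ t in a..b, g t ^ 2) - m ^ 2) := by nlinarith
  have := nonneg_of_mul_nonneg_right h3 (sub_pos.2 hlt)
  linarith

/-- Translation makes the integral telescope: only the last and the first step survive. It serves
for the increments of `∫ g²` and for those of the energy. -/
theorem integral_sub_comp_sub {F : ℝ → ℝ} {τ h : ℝ} (hτ : 0 ≤ τ) (hh : 0 ≤ h)
    (hF : IntervalIntegrable F volume (-h) τ) :
    ∫ t in (0 : ℝ)..τ, (F t - F (t - h))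
      = (∫ t in (τ - h)..τ, F t) - ∫ t in (-h)..0, F t := by
  have hi : ∀ c ∈ Icc (-h) τ, ∀ d ∈ Icc (-h) τ, IntervalIntegrable F volume c d :=
    fun c hc d hd => hF.mono_set (by
      rw [uIcc_of_le (by linarith : -h ≤ τ)]
      exact (convex_Icc (-h) τ).ordConnected.uIcc_subset hc hd)
  have m0 : (-h) ∈ Icc (-h) τ := ⟨le_rfl, by linarith⟩
  have m1 : (0 : ℝ) ∈ Icc (-h) τ := ⟨by linarith, hτ⟩
  have m2 : τ - h ∈ Icc (-h) τ := ⟨by linarith, by linarith⟩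
  have m3 : τ ∈ Icc (-h) τ := ⟨by linarith, le_rfl⟩
  have hs : IntervalIntegrable (fun t => F (t - h)) volume 0 τ := by
    have := (hi _ m0 _ m2).comp_sub_right h
    simpa using this
  rw [intervalIntegral.integral_sub (hi _ m1 _ m3) hs,
    intervalIntegral.integral_comp_sub_right (fun t => F t) h, zero_sub]
  have h1 := intervalIntegral.integral_add_adjacent_intervals (hi _ m0 _ m1) (hi _ m1 _ m3)
  have h2 := intervalIntegral.integral_add_adjacent_intervals (hi _ m0 _ m2) (hi _ m2 _ m3)
  linarith

theorem max_sub_zero_mem_Icc {t h τ : ℝ} (hh : 0 ≤ h) (ht : t ∈ Icc 0 τ) :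
    max (t - h) 0 ∈ Icc 0 τ :=
  ⟨le_max_right _ _, max_le (by linarith [ht.2]) (ht.1.trans ht.2)⟩

namespace IsPrimitive

variable {τ : ℝ} {u g w : ℝ → ℝ}

theorem sub_eq_integral (hτ : 0 ≤ τ) (hu : IsPrimitive τ u g) {r t : ℝ} (hr : r ∈ Icc 0 τ)
    (ht : t ∈ Icc 0 τ) : u t - u r = ∫ x in r..t, g x := by
  have hi : ∀ c ∈ Icc 0 τ, IntervalIntegrable g volume 0 c := fun c hc =>
    hu.intervalIntegrable.mono_set (by
      rw [uIcc_of_le hτ, uIcc_of_le hc.1]; exact Icc_subset_Icc_right hc.2)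
  rw [hu.eq_add_integral r hr, hu.eq_add_integral t ht,
    ← intervalIntegral.integral_interval_sub_left (hi t ht) (hi r hr)]
  ring

theorem continuousOn_sub_max (hτ : 0 ≤ τ) (hu : IsPrimitive τ u g) {h : ℝ} (hh : 0 ≤ h) :
    ContinuousOn (fun t => u t - u (max (t - h) 0)) (Icc 0 τ) :=
  (hu.continuousOn hτ).sub ((hu.continuousOn hτ).comp (by fun_prop)
    fun _ ht => max_sub_zero_mem_Icc hh ht)

/-- Cauchy-Schwarz bounds the squared increment by `h` times the increment of `U(t) = ∫₀ᵗ g²`. The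
integral of the latter telescopes to the integral of `U` over the last step, which is at most `h
U(τ)` by monotonicity. With `U = 0` on negative times, steps reaching below `0` need no separate
treatment. -/
theorem integral_sq_sub_le (hτ : 0 ≤ τ) (hu : IsPrimitive τ u g) (hg : MemLp g 2 (leb τ))
    {h : ℝ} (hh : 0 ≤ h) :
    ∫ t, (u t - u (max (t - h) 0)) ^ 2 ∂(leb τ) ≤ h ^ 2 * ∫ t, g t ^ 2 ∂(leb τ) := by
  have hg2 : IntervalIntegrable (fun t => g t ^ 2) volume 0 τ :=
    (intervalIntegrable_iff_leb hτ).2 hg.integrable_sq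
  have hi : ∀ c ∈ Icc 0 τ, ∀ d ∈ Icc 0 τ, uIcc c d ⊆ uIcc 0 τ := fun c hc d hd => by
    rw [uIcc_of_le hτ]; exact (convex_Icc 0 τ).ordConnected.uIcc_subset hc hd
  set U : ℝ → ℝ := fun x => ∫ y in (0 : ℝ)..(max x 0), g y ^ 2 with hU
  have m0 : (0 : ℝ) ∈ Icc 0 τ := ⟨le_rfl, hτ⟩
  have hUmono : MonotoneOn U (Iic τ) := by
    intro x hx y hy hxy
    have hmx : max x 0 ∈ Icc 0 τ := ⟨le_max_right _ _, max_le hx hτ⟩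
    have hmy : max y 0 ∈ Icc 0 τ := ⟨le_max_right _ _, max_le hy hτ⟩
    have h1 := intervalIntegral.integral_add_adjacent_intervals
      (hg2.mono_set (hi _ m0 _ hmx)) (hg2.mono_set (hi _ hmx _ hmy))
    have h2 : 0 ≤ ∫ y in (max x 0)..(max y 0), g y ^ 2 :=
      intervalIntegral.integral_nonneg (max_le_max_right _ hxy) fun _ _ => sq_nonneg _
    simp only [hU]; linarith
  have hUi : ∀ c ≤ τ, ∀ d ≤ τ, IntervalIntegrable U volume c d := fun c hc d hd =>
    (hUmono.mono fun x hx => hx.2.trans (max_le hc hd)).intervalIntegrable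
  have hpt : ∀ t ∈ Icc 0 τ, (u t - u (max (t - h) 0)) ^ 2 ≤ h * (U t - U (t - h)) := by
    intro t ht
    have hm := max_sub_zero_mem_Icc hh ht
    have hle : max (t - h) 0 ≤ t := max_le (by linarith) ht.1
    rw [hu.sub_eq_integral hτ hm ht]
    refine (sq_integral_le hle (hu.intervalIntegrable.mono_set (hi _ hm _ ht))
      (hg2.mono_set (hi _ hm _ ht))).trans ?_
    have h1 := intervalIntegral.integral_add_adjacent_intervals
      (hg2.mono_set (hi _ m0 _ hm)) (hg2.mono_set (hi _ hm _ ht))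
    have h2 : U t - U (t - h) = ∫ x in (max (t - h) 0)..t, g x ^ 2 := by
      simp only [hU, max_eq_left ht.1]; linarith
    rw [h2]
    refine mul_le_mul_of_nonneg_right ?_
      (intervalIntegral.integral_nonneg hle fun _ _ => sq_nonneg _)
    linarith [le_max_left (t - h) 0]
  have hUs : IntervalIntegrable (fun t => U (t - h)) volume 0 τ := by
    have := (hUi (-h) (by linarith) (τ - h) (by linarith)).comp_sub_right h
    simpa using this
  have hc := (hu.continuousOn_sub_max hτ hh).pow 2
  rw [integral_leb hτ, integral_leb hτ]
  calc ∫ t in (0 : ℝ)..τ, (u t - u (max (t - h) 0)) ^ 2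
      ≤ ∫ t in (0 : ℝ)..τ, h * (U t - U (t - h)) := by
        refine intervalIntegral.integral_mono_on hτ ?_ (((hUi _ hτ _ le_rfl).sub hUs).const_mul h)
          hpt
        exact hc.intervalIntegrable_of_Icc hτ
    _ = h * ((∫ t in (τ - h)..τ, U t) - ∫ t in (-h)..0, U t) := by
        rw [intervalIntegral.integral_const_mul,
          integral_sub_comp_sub hτ hh (hUi _ (by linarith) _ le_rfl)]
    _ = h * ∫ t in (τ - h)..τ, U t := by
        have : ∫ t in (-h)..0, U t = ∫ t in (-h)..0, 0 := by
          refine intervalIntegral.integral_congr fun t ht => ?_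
          rw [uIcc_of_le (by linarith)] at ht
          simp [hU, max_eq_right ht.2]
        simp [this]
    _ ≤ h * ∫ t in (τ - h)..τ, U τ := by
        refine mul_le_mul_of_nonneg_left ?_ hh
        refine intervalIntegral.integral_mono_on (by linarith)
          (hUi _ (by linarith) _ le_rfl) (by simp) fun t ht => ?_
        exact hUmono ht.2 (mem_Iic.2 le_rfl) ht.2
    _ = h ^ 2 * ∫ t in (0 : ℝ)..τ, g t ^ 2 := by
        simp [hU, max_eq_left hτ]; ring

/-- The backward difference quotients with step `1 / (n + 1)`, for the extension of `u` by its
value at `0`. -/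
def _root_.ThetaNetwork.diffQuot (u : ℝ → ℝ) (n : ℕ) (t : ℝ) : ℝ :=
  (n + 1) * (u t - u (max (t - 1 / (n + 1)) 0))

theorem continuousOn_diffQuot (hτ : 0 ≤ τ) (hu : IsPrimitive τ u g) (n : ℕ) :
    ContinuousOn (diffQuot u n) (Icc 0 τ) :=
  continuousOn_const.mul (hu.continuousOn_sub_max hτ (by positivity))

theorem memLp_diffQuot (hτ : 0 ≤ τ) (hu : IsPrimitive τ u g) (n : ℕ) :
    MemLp (diffQuot u n) 2 (leb τ) := by
  have hc := hu.continuousOn_diffQuot hτ n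
  exact (memLp_two_iff_integrable_sq (integrable_of_continuousOn hc).1).2
    (integrable_of_continuousOn (hc.pow 2))

theorem integral_sq_diffQuot_le (hτ : 0 ≤ τ) (hu : IsPrimitive τ u g) (hg : MemLp g 2 (leb τ))
    (n : ℕ) : ∫ t, diffQuot u n t ^ 2 ∂(leb τ) ≤ ∫ t, g t ^ 2 ∂(leb τ) := by
  have h := hu.integral_sq_sub_le hτ hg (h := 1 / (n + 1)) (by positivity)
  have hn : (0 : ℝ) < n + 1 := by positivity
  simp only [diffQuot, mul_pow]
  rw [integral_const_mul]
  calc _ ≤ ((n : ℝ) + 1) ^ 2 * ((1 / (n + 1)) ^ 2 * ∫ t, g t ^ 2 ∂(leb τ)) := by gcongr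
    _ = _ := by field_simp

theorem ae_tendsto_diffQuot (hτ : 0 ≤ τ) (hu : IsPrimitive τ u g) :
    ∀ᵐ t ∂(leb τ), Tendsto (fun n => diffQuot u n t) atTop (𝓝 (g t)) := by
  filter_upwards [hu.ae_hasDerivAt hτ, ae_mem_Ioo_leb τ] with t ht hm
  have h0 : Tendsto (fun n : ℕ => 1 / ((n : ℝ) + 1)) atTop (𝓝 0) :=
    tendsto_one_div_add_atTop_nhds_zero_nat
  have h1 : Tendsto (fun n : ℕ => t - 1 / ((n : ℝ) + 1)) atTop (𝓝[≠] t) := by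
    refine tendsto_nhdsWithin_iff.2 ⟨by simpa using h0.const_sub t, Eventually.of_forall fun n => ?_⟩
    have : (0 : ℝ) < 1 / ((n : ℝ) + 1) := by positivity
    simp only [mem_compl_iff, mem_singleton_iff]; intro h; linarith
  refine (ht.tendsto_slope.comp h1).congr' ?_
  filter_upwards [h0.eventually_lt_const hm.1] with n hn
  have hn' : (0 : ℝ) < n + 1 := by positivity
  simp only [Function.comp, slope, vsub_eq_sub, smul_eq_mul, diffQuot]
  rw [max_eq_left (by linarith)]
  field_simp
  ring

/-- A bound independent of `n`; as a function of arc length it dominates in the passage to the limit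
over space-time. -/
theorem abs_integral_mul_diffQuot_le (hτ : 0 ≤ τ) (hu : IsPrimitive τ u g)
    (hg : MemLp g 2 (leb τ)) (hw : MemLp w 2 (leb τ)) (n : ℕ) :
    |∫ t, w t * diffQuot u n t ∂(leb τ)|
      ≤ ∫ t, w t ^ 2 ∂(leb τ) + ∫ t, g t ^ 2 ∂(leb τ) := by
  have hv := hu.memLp_diffQuot hτ n
  rw [← Real.norm_eq_abs]
  refine (norm_integral_le_of_norm_le (hw.integrable_sq.add hv.integrable_sq)
    (ae_of_all _ fun t => ?_)).trans ?_
  · simp only [Pi.add_apply]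
    rw [Real.norm_eq_abs, abs_le]
    constructor <;> nlinarith [sq_nonneg (w t + diffQuot u n t), sq_nonneg (w t - diffQuot u n t)]
  · simp only [Pi.add_apply]
    rw [integral_add hw.integrable_sq hv.integrable_sq]
    exact add_le_add_right (hu.integral_sq_diffQuot_le hτ hg n) _

/-- Lower half of weak convergence. The quotients `vₙ` converge to `g` almost everywhere and `∫ vₙ²
≤ ∫ g²`. Fatou's lemma for `(w + vₙ)²` bounds `∫ w² + ∫ vₙ² + 2 ∫ w vₙ` asymptotically from below,
and the norm bound lets the square terms be discarded. The upper half follows by replacing `w` with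
`-w`. -/
theorem eventually_lt_integral_mul_diffQuot (hτ : 0 ≤ τ) (hu : IsPrimitive τ u g)
    (hg : MemLp g 2 (leb τ)) (hw : MemLp w 2 (leb τ)) {a : ℝ}
    (ha : a < ∫ t, w t * g t ∂(leb τ)) :
    ∀ᶠ n in atTop, a < ∫ t, w t * diffQuot u n t ∂(leb τ) := by
  set X := ∫ t, w t ^ 2 ∂(leb τ) + ∫ t, g t ^ 2 ∂(leb τ)
  have hexp : ∀ v : ℝ → ℝ, MemLp v 2 (leb τ) → ∫ t, (w t + v t) ^ 2 ∂(leb τ)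
      = ∫ t, w t ^ 2 ∂(leb τ) + ∫ t, v t ^ 2 ∂(leb τ) + 2 * ∫ t, w t * v t ∂(leb τ) := by
    intro v hv
    have : ∀ t, (w t + v t) ^ 2 = w t ^ 2 + v t ^ 2 + 2 * (w t * v t) := fun t => by ring
    simp_rw [this]
    have h1 : Integrable (fun t => w t ^ 2 + v t ^ 2) (leb τ) :=
      hw.integrable_sq.add hv.integrable_sq
    have h2 : Integrable (fun t => 2 * (w t * v t)) (leb τ) := (hw.integrable_mul hv).const_mul 2
    rw [integral_add h1 h2, integral_add hw.integrable_sq hv.integrable_sq, integral_const_mul]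
  have hlim : ∫⁻ t, ENNReal.ofReal ((w t + g t) ^ 2) ∂(leb τ)
      ≤ liminf (fun n => ∫⁻ t, ENNReal.ofReal ((w t + diffQuot u n t) ^ 2) ∂(leb τ)) atTop := by
    refine le_trans (lintegral_mono_ae ?_) (lintegral_liminf_le' fun n => ?_)
    · filter_upwards [hu.ae_tendsto_diffQuot hτ] with t ht
      have : Tendsto (fun n => ENNReal.ofReal ((w t + diffQuot u n t) ^ 2)) atTop
          (𝓝 (ENNReal.ofReal ((w t + g t) ^ 2))) :=
        ENNReal.tendsto_ofReal ((ht.const_add (w t)).pow 2)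
      exact this.liminf_eq.ge
    · exact (hw.add (hu.memLp_diffQuot hτ n)).integrable_sq.1.aemeasurable.ennreal_ofReal
  have hof : ∀ v : ℝ → ℝ, MemLp v 2 (leb τ) →
      ∫⁻ t, ENNReal.ofReal ((w t + v t) ^ 2) ∂(leb τ)
        = ENNReal.ofReal (∫ t, (w t + v t) ^ 2 ∂(leb τ)) := fun v hv =>
    (ofReal_integral_eq_lintegral_ofReal (hw.add hv).integrable_sq
      (ae_of_all _ fun t => sq_nonneg _)).symm
  rw [hof g hg, hexp g hg] at hlim
  simp_rw [fun n => hof _ (hu.memLp_diffQuot hτ n)] at hlim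
  -- `ENNReal.ofReal` truncates negative numbers, so this case is separate. Here nonnegativity of `∫
  -- (w + vₙ)²` alone gives `2 ∫ w vₙ ≥ -X > 2a`.
  by_cases hX : X + 2 * a < 0
  · refine Eventually.of_forall fun n => ?_
    have h1 := abs_integral_mul_diffQuot_le hτ hu hg hw n
    have h2 := hexp _ (hu.memLp_diffQuot hτ n)
    have h3 : 0 ≤ ∫ t, (w t + diffQuot u n t) ^ 2 ∂(leb τ) :=
      integral_nonneg fun _ => sq_nonneg _
    have h4 := hu.integral_sq_diffQuot_le hτ hg n
    simp only [X] at hX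
    linarith
  have hlt : ENNReal.ofReal (X + 2 * a) < ENNReal.ofReal (X + 2 * ∫ t, w t * g t ∂(leb τ)) :=
    (ENNReal.ofReal_lt_ofReal_iff (by linarith [not_lt.1 hX])).2 (by linarith)
  filter_upwards [eventually_lt_of_lt_liminf (hlt.trans_le hlim)] with n hn
  have h1 := (ENNReal.ofReal_lt_ofReal_iff_of_nonneg (not_lt.1 hX)).1 hn
  rw [hexp _ (hu.memLp_diffQuot hτ n)] at h1
  have h4 := hu.integral_sq_diffQuot_le hτ hg n
  simp only [X] at h1
  linarith

/-- The difference quotients of an indefinite integral of an `L²` function `g` converge to `g`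
weakly in `L²`. -/
theorem tendsto_integral_mul_diffQuot (hτ : 0 ≤ τ) (hu : IsPrimitive τ u g)
    (hg : MemLp g 2 (leb τ)) (hw : MemLp w 2 (leb τ)) :
    Tendsto (fun n => ∫ t, w t * diffQuot u n t ∂(leb τ)) atTop
      (𝓝 (∫ t, w t * g t ∂(leb τ))) := by
  refine tendsto_order.2 ⟨fun a ha => hu.eventually_lt_integral_mul_diffQuot hτ hg hw ha,
    fun a ha => ?_⟩
  have h := hu.eventually_lt_integral_mul_diffQuot hτ hg hw.neg (a := -a)
    (by simpa [integral_neg] using ha)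
  filter_upwards [h] with n hn
  simpa [integral_neg] using hn

end IsPrimitive

/-! ### The flux and the convexity of the energy density -/

theorem pflux_mul_self {p : ℝ} (hp : 1 < p) (x : ℝ) : pflux p x * x = |x| ^ p := by
  rcases eq_or_ne x 0 with rfl | hx
  · simp [pflux, Real.zero_rpow (by linarith : p ≠ 0)]
  · have h : 0 < |x| := abs_pos.2 hx
    rw [pflux, mul_assoc, ← abs_mul_abs_self x, ← mul_assoc,
      ← Real.rpow_add_one h.ne', ← Real.rpow_add_one h.ne']
    congr 1; ring

theorem abs_pflux {p : ℝ} (hp : 1 < p) (x : ℝ) : |pflux p x| = |x| ^ (p - 1) := by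
  rcases eq_or_ne x 0 with rfl | hx
  · simp [pflux, Real.zero_rpow (by linarith : p - 1 ≠ 0)]
  · have h : 0 < |x| := abs_pos.2 hx
    rw [pflux, abs_mul, abs_of_nonneg (Real.rpow_nonneg h.le _), ← Real.rpow_add_one h.ne']
    congr 1; ring

theorem continuous_pflux {p : ℝ} (hp : 1 < p) : Continuous (pflux p) := by
  rw [continuous_iff_continuousAt]
  intro x
  rcases eq_or_ne x 0 with rfl | hx
  · have h0 : pflux p 0 = 0 := by simp [pflux]
    rw [ContinuousAt, h0, tendsto_zero_iff_abs_tendsto_zero]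
    have h1 : Continuous fun x : ℝ => |x| ^ (p - 1) :=
      continuous_abs.rpow_const fun _ => Or.inr (by linarith)
    have h2 := h1.tendsto 0
    simp only [abs_zero, Real.zero_rpow (by linarith : p - 1 ≠ 0)] at h2
    exact h2.congr fun x => (abs_pflux hp x).symm
  · exact (continuousAt_id.abs.rpow_const (Or.inl (abs_pos.2 hx).ne')).mul continuousAt_id

/-- The tangent line inequality for the convex function `|x|^p`. -/
theorem rpow_abs_add_le {p : ℝ} (hp : 1 < p) (x y : ℝ) :
    |x| ^ p + p * (pflux p x * (y - x)) ≤ |y| ^ p := by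
  have hpq := Real.HolderConjugate.conjExponent hp
  set q := Real.conjExponent p
  -- Young's inequality for `|y|` and `|x|^(p-1)` is the tangent line inequality, because
  -- `(|x|^(p-1))^q = |x|^p`.
  have h1 := Real.young_inequality_of_nonneg (abs_nonneg y)
    (Real.rpow_nonneg (abs_nonneg x) (p - 1)) hpq
  have h2 : (|x| ^ (p - 1)) ^ q = |x| ^ p := by
    rw [← Real.rpow_mul (abs_nonneg x), hpq.sub_one_mul_conj]
  have h3 : pflux p x * y ≤ |y| * |x| ^ (p - 1) := by
    rw [← abs_pflux hp, mul_comm |y|, ← abs_mul]; exact le_abs_self _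
  have h4 : p * (|y| ^ p / p + |x| ^ p / q) = |y| ^ p + (p - 1) * |x| ^ p := by
    rw [mul_add, mul_div_cancel₀ _ hpq.ne_zero, div_eq_mul_inv, ← mul_assoc, mul_right_comm,
      ← div_eq_mul_inv, hpq.div_conj_eq_sub_one]
  rw [h2] at h1
  have h5 : p * (pflux p x * y) ≤ |y| ^ p + (p - 1) * |x| ^ p := by
    rw [← h4]; exact mul_le_mul_of_nonneg_left (h3.trans h1) (by linarith)
  have h6 := pflux_mul_self hp x
  rw [mul_sub, h6]; linarith

theorem MemLp.integrable_abs_rpow {p : ℝ} (hp : 1 < p) {μ : Measure ℝ} {f : ℝ → ℝ}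
    (hf : MemLp f (ENNReal.ofReal p) μ) : Integrable (fun s => |f s| ^ p) μ := by
  have := hf.integrable_norm_rpow (by simp; linarith) (by simp)
  rwa [ENNReal.toReal_ofReal (by linarith)] at this

theorem MemLp.integrable_of_ofReal {p : ℝ} (hp : 1 < p) {μ : Measure ℝ} [IsFiniteMeasure μ]
    {f : ℝ → ℝ} (hf : MemLp f (ENNReal.ofReal p) μ) : Integrable f μ :=
  hf.integrable (by simpa using hp.le)

/-! ### The equation on a single time slice -/

/-- The properties of a weak solution at almost every fixed time: `ϑ`, `ϑ'` and `v` are the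
angle, its arc length derivative and its time derivative, and `w` is the derivative of the
flux. -/
structure IsRegularSlice (p b k₀ k₁ : ℝ) (ϑ ϑ' v w : ℝ → ℝ) : Prop where
  isPrimitive : IsPrimitive b ϑ ϑ'
  memLp : MemLp ϑ' (ENNReal.ofReal p) (leb b)
  memLp_time : MemLp v 2 (leb b)
  flux : ∃ u : ℝ → ℝ, (∀ᵐ s ∂(leb b), u s = ϑ' s) ∧ u 0 = 0 ∧ u b = 0 ∧
    IsPrimitive b (fun s => pflux p (u s)) w
  eq : ∀ᵐ s ∂(leb b), w s = v s + k₀ * Real.sin (ϑ s) - k₁ * Real.cos (ϑ s)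

namespace IsRegularSlice

variable {p b k₀ k₁ : ℝ} {ϑ ϑ' v w Ψ ψ : ℝ → ℝ}

/-- Since the flux itself vanishes at both end points, `Ψ` needs no boundary condition. This admits
`sin ϑ`, `cos ϑ` and differences of angles as test functions. -/
theorem integral_flux_mul (h : IsRegularSlice p b k₀ k₁ ϑ ϑ' v w) (hb : 0 ≤ b)
    (hΨ : IsPrimitive b Ψ ψ) : Integrable (fun s => pflux p (ϑ' s) * ψ s) (leb b) ∧
      ∫ s, pflux p (ϑ' s) * ψ s ∂(leb b) = -∫ s, w s * Ψ s ∂(leb b) := by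
  obtain ⟨u, hu, hu0, hub, hup⟩ := h.flux
  have h1 : ∀ᵐ s ∂(leb b), pflux p (u s) * ψ s = pflux p (ϑ' s) * ψ s := by
    filter_upwards [hu] with s hs; rw [hs]
  refine ⟨(integrable_continuousOn_mul hb (hup.continuousOn hb) (hΨ.integrable hb)).congr h1, ?_⟩
  rw [← integral_congr_ae h1]
  exact hup.integral_mul_eq_neg hb hΨ (by simp [hu0, pflux]) (by simp [hub, pflux])

/-- The subdifferential inequality for the `p`-energy. -/
theorem integral_rpow_sub_le (h : IsRegularSlice p b k₀ k₁ ϑ ϑ' v w) (hp : 1 < p) (hb : 0 ≤ b)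
    (hΨ : IsPrimitive b Ψ ψ) (hψ : MemLp ψ (ENNReal.ofReal p) (leb b)) :
    ∫ s, |ϑ' s| ^ p ∂(leb b) - ∫ s, |ψ s| ^ p ∂(leb b)
      ≤ -p * ∫ s, w s * (ϑ s - Ψ s) ∂(leb b) := by
  obtain ⟨h1, h2⟩ := h.integral_flux_mul hb (hΨ.sub hb h.isPrimitive)
  have h3 : ∫ s, (|ϑ' s| ^ p + p * (pflux p (ϑ' s) * (ψ s - ϑ' s))) ∂(leb b)
      ≤ ∫ s, |ψ s| ^ p ∂(leb b) :=
    integral_mono ((MemLp.integrable_abs_rpow hp h.memLp).add (h1.const_mul p))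
      (MemLp.integrable_abs_rpow hp hψ) fun s => rpow_abs_add_le hp _ _
  rw [integral_add (MemLp.integrable_abs_rpow hp h.memLp) (h1.const_mul p), integral_const_mul,
    h2] at h3
  have h4 : ∫ s, w s * (ϑ s - Ψ s) ∂(leb b) = -∫ s, w s * (Ψ s - ϑ s) ∂(leb b) := by
    rw [← integral_neg]; congr 1; ext s; ring
  rw [h4]; linarith

theorem integrable_time (h : IsRegularSlice p b k₀ k₁ ϑ ϑ' v w) : Integrable v (leb b) :=
  h.memLp_time.integrable (by norm_num)

theorem integral_w_mul (h : IsRegularSlice p b k₀ k₁ ϑ ϑ' v w) {g : ℝ → ℝ}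
    (hv : Integrable (fun s => v s * g s) (leb b))
    (hs : Integrable (fun s => Real.sin (ϑ s) * g s) (leb b))
    (hc : Integrable (fun s => Real.cos (ϑ s) * g s) (leb b)) :
    ∫ s, w s * g s ∂(leb b) = ∫ s, v s * g s ∂(leb b)
      + k₀ * ∫ s, Real.sin (ϑ s) * g s ∂(leb b) - k₁ * ∫ s, Real.cos (ϑ s) * g s ∂(leb b) := by
  have hvs : Integrable (fun s => v s * g s + k₀ * (Real.sin (ϑ s) * g s)) (leb b) :=
    hv.add (hs.const_mul k₀)
  rw [← integral_const_mul, ← integral_const_mul, ← integral_add hv (hs.const_mul k₀),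
    ← integral_sub hvs (hc.const_mul k₁)]
  refine integral_congr_ae ?_
  filter_upwards [h.eq] with s hs
  rw [hs]; ring

theorem continuousOn_sin (h : IsRegularSlice p b k₀ k₁ ϑ ϑ' v w) (hb : 0 ≤ b) :
    ContinuousOn (fun s => Real.sin (ϑ s)) (Icc 0 b) :=
  (h.isPrimitive.sin hb).continuousOn hb

theorem continuousOn_cos (h : IsRegularSlice p b k₀ k₁ ϑ ϑ' v w) (hb : 0 ≤ b) :
    ContinuousOn (fun s => Real.cos (ϑ s)) (Icc 0 b) :=
  (h.isPrimitive.cos hb).continuousOn hb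

theorem integrable_time_mul (h : IsRegularSlice p b k₀ k₁ ϑ ϑ' v w) (hb : 0 ≤ b) {g : ℝ → ℝ}
    (hg : ContinuousOn g (Icc 0 b)) : Integrable (fun s => v s * g s) (leb b) := by
  simp_rw [mul_comm (v _)]
  exact integrable_continuousOn_mul hb hg h.integrable_time

/-- Testing the equation with `sin ϑ` and `cos ϑ`. -/
theorem vecG_add_vecMul (h : IsRegularSlice p b k₀ k₁ ϑ ϑ' v w) (hp : 1 < p) (hb : 0 ≤ b) :
    vecG p b ϑ ϑ' + ![k₀, k₁] ᵥ* matA b ϑ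
      = ![-∫ s, v s * Real.sin (ϑ s) ∂(leb b), ∫ s, v s * Real.cos (ϑ s) ∂(leb b)] := by
  have hs := h.continuousOn_sin hb
  have hc := h.continuousOn_cos hb
  have h1 := (h.integral_flux_mul hb (h.isPrimitive.sin hb)).2
  have h2 := (h.integral_flux_mul hb (h.isPrimitive.cos hb)).2
  rw [h.integral_w_mul (h.integrable_time_mul hb hs) (integrable_of_continuousOn (hs.mul hs))
    (integrable_of_continuousOn (hc.mul hs))] at h1
  rw [h.integral_w_mul (h.integrable_time_mul hb hc) (integrable_of_continuousOn (hs.mul hc))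
    (integrable_of_continuousOn (hc.mul hc))] at h2
  have e1 : ∀ s, pflux p (ϑ' s) * (Real.cos (ϑ s) * ϑ' s) = |ϑ' s| ^ p * Real.cos (ϑ s) :=
    fun s => by rw [← pflux_mul_self hp]; ring
  have e2 : ∀ s, pflux p (ϑ' s) * (-Real.sin (ϑ s) * ϑ' s) = -(|ϑ' s| ^ p * Real.sin (ϑ s)) :=
    fun s => by rw [← pflux_mul_self hp]; ring
  have e3 : ∀ s, Real.cos (ϑ s) * Real.sin (ϑ s) = Real.sin (ϑ s) * Real.cos (ϑ s) :=
    fun s => mul_comm _ _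
  simp_rw [e1, e3, ← sq] at h1
  simp_rw [e2, ← sq] at h2
  rw [integral_neg] at h2
  ext i
  fin_cases i
  · simp [vecG, matA, h1]
    ring
  · simp [vecG, matA]
    linarith

/-- The last two terms will cancel in the sum over the three curves, leaving the dissipation `∫ v²`.
-/
theorem integral_w_mul_time (h : IsRegularSlice p b k₀ k₁ ϑ ϑ' v w) (hb : 0 ≤ b) :
    ∫ s, w s * v s ∂(leb b) = ∫ s, v s ^ 2 ∂(leb b) + k₀ * ∫ s, v s * Real.sin (ϑ s) ∂(leb b)
      - k₁ * ∫ s, v s * Real.cos (ϑ s) ∂(leb b) := by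
  have hs := integrable_continuousOn_mul hb (h.continuousOn_sin hb) h.integrable_time
  have hc := integrable_continuousOn_mul hb (h.continuousOn_cos hb) h.integrable_time
  rw [h.integral_w_mul (by simpa [sq] using h.memLp_time.integrable_sq) hs hc]
  simp_rw [mul_comm (v _), sq]

end IsRegularSlice

/-! ### Regularity of almost every slice -/

theorem MemL2L2.ae_memLp {T b : ℝ} {f : ℝ → ℝ → ℝ} (hf : MemL2L2 T b f) :
    ∀ᵐ t ∂(leb T), MemLp (f t) 2 (leb b) := by
  have hf' : MemLp (Function.uncurry f) 2 ((leb T).prod (leb b)) := hf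
  filter_upwards [hf'.1.prodMk_left, hf'.integrable_sq.prod_right_ae] with t h1 h2
  exact (memLp_two_iff_integrable_sq h1).2 h2

theorem MemL2L2.ae_memLp_left {T b : ℝ} {f : ℝ → ℝ → ℝ} (hf : MemL2L2 T b f) :
    ∀ᵐ s ∂(leb b), MemLp (fun t => f t s) 2 (leb T) := by
  have hf' : MemLp (Function.uncurry f) 2 ((leb T).prod (leb b)) := hf
  filter_upwards [hf'.1.prodMk_right, hf'.integrable_sq.prod_left_ae] with t h1 h2
  exact (memLp_two_iff_integrable_sq h1).2 h2

theorem MemLinftyLp.ae_memLp {r T b : ℝ} {f : ℝ → ℝ → ℝ} (hf : MemLinftyLp r T b f) :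
    ∀ᵐ t ∂(leb T), MemLp (f t) (ENNReal.ofReal r) (leb b) := by
  obtain ⟨h, M, hM⟩ := hf
  filter_upwards [h.prodMk_left, hM] with t h1 h2
  exact ⟨h1, h2.trans_lt ENNReal.coe_lt_top⟩

namespace IsWeakSolution

variable {p : ℝ} {L : Fin 3 → ℝ} {T : ℝ} {θ₀ : Fin 3 → ℝ → ℝ} {θ θs θt : Fin 3 → ℝ → ℝ → ℝ}
  {lam mu : ℝ → EuclideanSpace ℝ (Fin 2)}

theorem exists_isRegularSlice (h : IsWeakSolution p L T θ₀ θ θs θt lam mu) (hp : 1 < p)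
    (hL : ∀ j, 0 < L j) (j : Fin 3) :
    ∃ w : ℝ → ℝ → ℝ, MemL2L2 T (L j) w ∧ ∀ᵐ t ∂(leb T),
      IsRegularSlice p (L j) (coeff (lam t) (mu t) j 0) (coeff (lam t) (mu t) j 1)
        (θ j t) (θs j t) (θt j t) (w t) := by
  obtain ⟨w, ⟨-, hw2, hwd⟩, hwe⟩ := h.flux_eq j
  refine ⟨w, hw2, ?_⟩
  obtain ⟨-, hs, hd⟩ := h.memLinftyW1p j
  filter_upwards [hw2.ae_memLp, hwd, hwe, hs.ae_memLp, hd, h.boundary j,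
    (h.memH1L2 j).2.1.ae_memLp, ae_mem_Ioo_leb T] with t h1 h2 h3 h4 h5 h6 h7 ht
  obtain ⟨u, huc, hue, hu0, hub⟩ := h6
  have hc : ContinuousOn (θ j t) (Icc 0 (L j)) :=
    (h.continuousOn j).comp (f := fun s => (t, s)) (by fun_prop)
      fun s hs => ⟨Ioo_subset_Icc_self ht, hs⟩
  refine ⟨h5.isPrimitive (hL j) (MemLp.integrable_of_ofReal hp h4) hc (ae_of_all _ fun _ => rfl),
    h4, h7, ⟨u, hue, hu0, hub, ?_⟩, h3⟩
  -- The flux of the continuous representative `u` from the boundary condition is a continuous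
  -- representative of the flux, hence an indefinite integral of `w`.
  refine h2.isPrimitive (hL j) (h1.integrable (by norm_num))
    ((continuous_pflux hp).comp_continuousOn huc) ?_
  filter_upwards [hue] with s hs
  rw [hs]

end IsWeakSolution

/-! ### Space-time integrals and the differentiated constraint -/

theorem leb_prod_leb (T b : ℝ) :
    (leb T).prod (leb b) = (volume : Measure (ℝ × ℝ)).restrict (Ioo 0 T ×ˢ Ioo 0 b) := by
  rw [leb, leb, Measure.prod_restrict, Measure.volume_eq_prod]

theorem leb_prod_leb_mono {T' T b : ℝ} (h : T' ≤ T) :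
    (leb T').prod (leb b) ≤ (leb T).prod (leb b) := by
  rw [leb_prod_leb, leb_prod_leb]
  exact Measure.restrict_mono (prod_mono (Ioo_subset_Ioo_right h) subset_rfl) le_rfl

theorem leb_mono {T' T : ℝ} (h : T' ≤ T) : leb T' ≤ leb T :=
  Measure.restrict_mono (Ioo_subset_Ioo_right h) le_rfl

theorem integrable_continuousOn_mul_prod {T b : ℝ} {G : ℝ × ℝ → ℝ} {f : ℝ × ℝ → ℝ}
    (hG : ContinuousOn G (Icc 0 T ×ˢ Icc 0 b)) (hf : Integrable f ((leb T).prod (leb b))) :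
    Integrable (fun x => G x * f x) ((leb T).prod (leb b)) := by
  have hsub : Ioo 0 T ×ˢ Ioo 0 b ⊆ Icc 0 T ×ˢ Icc 0 b :=
    prod_mono Ioo_subset_Icc_self Ioo_subset_Icc_self
  obtain ⟨C, hC⟩ := (isCompact_Icc.prod isCompact_Icc).exists_bound_of_continuousOn hG
  rw [leb_prod_leb] at hf ⊢
  have hm : MeasurableSet (Ioo 0 T ×ˢ Ioo 0 b) := measurableSet_Ioo.prod measurableSet_Ioo
  refine hf.bdd_mul (c := C) ((hG.mono hsub).aestronglyMeasurable hm) ?_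
  exact (ae_restrict_mem hm).mono fun x hx => hC x (hsub hx)

theorem IsPrimitive.mono {b c : ℝ} {F f : ℝ → ℝ} (h : IsPrimitive b F f) (hc : 0 ≤ c)
    (hcb : c ≤ b) : IsPrimitive c F f :=
  ⟨h.intervalIntegrable.mono_set (by
    rw [uIcc_of_le hc, uIcc_of_le (hc.trans hcb)]; exact Icc_subset_Icc_right hcb),
    fun x hx => h.eq_add_integral x ⟨hx.1, hx.2.trans hcb⟩⟩

/-- Indefinite integrals may be integrated with respect to a parameter. -/
theorem isPrimitive_integral {T b : ℝ} {q qt : ℝ → ℝ → ℝ}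
    (h : ∀ᵐ s ∂(leb b), IsPrimitive T (fun t => q t s) (fun t => qt t s))
    (hqt : Integrable (Function.uncurry qt) ((leb T).prod (leb b)))
    (hq : ∀ t ∈ Icc 0 T, Integrable (q t) (leb b)) (hT : 0 ≤ T) :
    IsPrimitive T (fun t => ∫ s, q t s ∂(leb b)) (fun t => ∫ s, qt t s ∂(leb b)) := by
  refine ⟨(intervalIntegrable_iff_leb hT).2 hqt.integral_prod_left, fun x hx => ?_⟩
  have hqx : Integrable (Function.uncurry qt) ((leb x).prod (leb b)) :=
    hqt.mono_measure (leb_prod_leb_mono hx.2)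
  have hqi : Integrable (fun s => ∫ t, qt t s ∂(leb x)) (leb b) := hqx.integral_prod_right
  rw [← integral_leb hx.1, integral_integral_swap hqx, ← integral_add (hq 0 ⟨le_rfl, hT⟩) hqi]
  refine integral_congr_ae ?_
  filter_upwards [h] with s hs
  rw [integral_leb hx.1]
  exact hs.eq_add_integral x hx

/-- After Fubini, the weak convergence in time at almost every `s` is integrated by dominated
convergence. -/
theorem tendsto_integral_integral_mul_diffQuot {T b : ℝ} (hT : 0 ≤ T) {u g w : ℝ → ℝ → ℝ}
    (hu : ContinuousOn (Function.uncurry u) (Icc 0 T ×ˢ Icc 0 b))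
    (hug : ∀ᵐ s ∂(leb b), IsPrimitive T (fun t => u t s) (fun t => g t s))
    (hg : MemL2L2 T b g) (hw : MemL2L2 T b w) :
    (∀ n, Integrable (Function.uncurry fun t s => w t s * diffQuot (fun t => u t s) n t)
      ((leb T).prod (leb b))) ∧
    Tendsto (fun n => ∫ t, ∫ s, w t s * diffQuot (fun t => u t s) n t ∂(leb b) ∂(leb T)) atTop
      (𝓝 (∫ t, ∫ s, w t s * g t s ∂(leb b) ∂(leb T))) := by
  have hi : ∀ n, Integrable (Function.uncurry fun t s => w t s * diffQuot (fun t => u t s) n t)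
      ((leb T).prod (leb b)) := by
    intro n
    have hc : ContinuousOn (fun x : ℝ × ℝ => diffQuot (fun t => u t x.2) n x.1)
        (Icc 0 T ×ˢ Icc 0 b) := by
      refine continuousOn_const.mul (hu.sub (hu.comp (f := fun x : ℝ × ℝ =>
        (max (x.1 - 1 / (n + 1)) 0, x.2)) (by fun_prop) fun x hx => ?_))
      exact ⟨max_sub_zero_mem_Icc (by positivity) hx.1, hx.2⟩
    refine (integrable_continuousOn_mul_prod hc (MemLp.integrable (by norm_num) hw)).congr
      (ae_of_all _ fun x => ?_)
    simp only [Function.uncurry]; ring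
  refine ⟨hi, ?_⟩
  have hwg : Integrable (Function.uncurry fun t s => w t s * g t s) ((leb T).prod (leb b)) :=
    MemLp.integrable_mul (p := 2) (q := 2) hw hg
  rw [integral_integral_swap hwg]
  simp_rw [fun n => integral_integral_swap (hi n)]
  refine tendsto_integral_of_dominated_convergence
    (fun s => ∫ t, w t s ^ 2 ∂(leb T) + ∫ t, g t s ^ 2 ∂(leb T))
    (fun n => (hi n).integral_prod_right.1) ?_ (fun n => ?_) ?_
  · exact (MemLp.integrable_sq hw).integral_prod_right.add
      (MemLp.integrable_sq hg).integral_prod_right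
  · filter_upwards [hug, hg.ae_memLp_left, hw.ae_memLp_left] with s h1 h2 h3
    exact h1.abs_integral_mul_diffQuot_le hT h2 h3 n
  · filter_upwards [hug, hg.ae_memLp_left, hw.ae_memLp_left] with s h1 h2 h3
    exact h1.tendsto_integral_mul_diffQuot hT h2 h3

namespace IsWeakSolution

variable {p : ℝ} {L : Fin 3 → ℝ} {T : ℝ} {θ₀ : Fin 3 → ℝ → ℝ} {θ θs θt : Fin 3 → ℝ → ℝ → ℝ}
  {lam mu : ℝ → EuclideanSpace ℝ (Fin 2)}

theorem continuousOn_slice (h : IsWeakSolution p L T θ₀ θ θs θt lam mu) (j : Fin 3) {t : ℝ}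
    (ht : t ∈ Icc 0 T) : ContinuousOn (θ j t) (Icc 0 (L j)) :=
  (h.continuousOn j).comp (f := fun s => (t, s)) (by fun_prop) fun _ hs => ⟨ht, hs⟩

theorem isPrimitive_integral_sin (h : IsWeakSolution p L T θ₀ θ θs θt lam mu) (hT : 0 < T)
    (j : Fin 3) : IsPrimitive T (fun t => ∫ s, Real.sin (θ j t s) ∂(leb (L j)))
      (fun t => ∫ s, θt j t s * Real.cos (θ j t s) ∂(leb (L j))) := by
  refine isPrimitive_integral ?_ ?_ (fun t ht => ?_) hT.le
  · filter_upwards [(h.memH1L2 j).ae_isPrimitive hT (h.continuousOn j)] with s hs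
    simpa only [mul_comm] using hs.sin hT.le
  · refine (integrable_continuousOn_mul_prod (Real.continuous_cos.comp_continuousOn
      (h.continuousOn j)) (MemLp.integrable (by norm_num) (h.memH1L2 j).2.1)).congr
      (ae_of_all _ fun x => ?_)
    simp only [Function.uncurry, Function.comp]; ring
  · exact integrable_of_continuousOn
      (Real.continuous_sin.comp_continuousOn (h.continuousOn_slice j ht))

theorem isPrimitive_integral_cos (h : IsWeakSolution p L T θ₀ θ θs θt lam mu) (hT : 0 < T)
    (j : Fin 3) : IsPrimitive T (fun t => ∫ s, Real.cos (θ j t s) ∂(leb (L j)))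
      (fun t => -∫ s, θt j t s * Real.sin (θ j t s) ∂(leb (L j))) := by
  simp_rw [← integral_neg]
  refine isPrimitive_integral ?_ ?_ (fun t ht => ?_) hT.le
  · filter_upwards [(h.memH1L2 j).ae_isPrimitive hT (h.continuousOn j)] with s hs
    refine (hs.cos hT.le).congr_deriv hT.le (ae_of_all _ fun t => ?_)
    ring
  · refine (integrable_continuousOn_mul_prod (Real.continuous_sin.comp_continuousOn
      (h.continuousOn j)) (MemLp.integrable (by norm_num) (h.memH1L2 j).2.1)).neg.congr
      (ae_of_all _ fun x => ?_)
    simp only [Function.uncurry, Function.comp, Pi.neg_apply]; ring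
  · exact integrable_of_continuousOn
      (Real.continuous_cos.comp_continuousOn (h.continuousOn_slice j ht))

/-- The constraint, differentiated in time. -/
theorem ae_integral_time_eq (h : IsWeakSolution p L T θ₀ θ θs θt lam mu) (hT : 0 < T)
    (i j : Fin 3) : ∀ᵐ t ∂(leb T),
      ∫ s, θt i t s * Real.sin (θ i t s) ∂(leb (L i))
        = ∫ s, θt j t s * Real.sin (θ j t s) ∂(leb (L j)) ∧
      ∫ s, θt i t s * Real.cos (θ i t s) ∂(leb (L i))
        = ∫ s, θt j t s * Real.cos (θ j t s) ∂(leb (L j)) := by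
  filter_upwards [(h.isPrimitive_integral_sin hT i).ae_eq hT.le (h.isPrimitive_integral_sin hT j)
      fun t ht => (h.concurrent t ht i j).2,
    (h.isPrimitive_integral_cos hT i).ae_eq hT.le (h.isPrimitive_integral_cos hT j)
      fun t ht => (h.concurrent t ht i j).1] with t h1 h2
  exact ⟨neg_injective h2, h1⟩

end IsWeakSolution

/-! ### The energy inequality -/

theorem MemLinftyLp.integrable_integral_rpow {p T b : ℝ} (hp : 1 < p) {f : ℝ → ℝ → ℝ}
    (hf : MemLinftyLp p T b f) :
    Integrable (fun t => ∫ s, |f t s| ^ p ∂(leb b)) (leb T) := by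
  have hslice := hf.ae_memLp
  obtain ⟨hm, M, hM⟩ := hf
  have hm' : AEStronglyMeasurable (fun t => ∫ s, |f t s| ^ p ∂(leb b)) (leb T) :=
    ((continuous_abs.rpow_const fun _ => Or.inr (by linarith)).comp_aestronglyMeasurable
      hm).integral_prod_right'
  refine Integrable.of_bound hm' ((M : ℝ) ^ p) ?_
  filter_upwards [hslice, hM] with t h1 h2
  have hnn : 0 ≤ ∫ s, |f t s| ^ p ∂(leb b) := integral_nonneg fun s => by positivity
  rw [h1.eLpNorm_eq_integral_rpow_norm (by simp; linarith) (by simp),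
    ENNReal.toReal_ofReal (by linarith), ← ENNReal.ofReal_coe_nnreal] at h2
  replace h2 := (ENNReal.ofReal_le_ofReal_iff M.coe_nonneg).1 h2
  rw [Real.norm_of_nonneg hnn]
  calc _ = ((∫ s, |f t s| ^ p ∂(leb b)) ^ p⁻¹) ^ p := by
        rw [← Real.rpow_mul hnn, inv_mul_cancel₀ (by linarith), Real.rpow_one]
    _ ≤ _ := Real.rpow_le_rpow (by positivity) h2 (by linarith)

theorem sum_coeff (lam mu : EuclideanSpace ℝ (Fin 2)) (i : Fin 2) :
    ∑ j, coeff lam mu j i = 0 := by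
  simp [coeff, Fin.sum_univ_three]

namespace IsWeakSolution

variable {p : ℝ} {L : Fin 3 → ℝ} {T : ℝ} {θ₀ θ₀' : Fin 3 → ℝ → ℝ}
  {θ θs θt w : Fin 3 → ℝ → ℝ → ℝ} {lam mu : ℝ → EuclideanSpace ℝ (Fin 2)}

theorem isPrimitive_initial (h : IsWeakSolution p L T θ₀ θ θs θt lam mu) (hp : 1 < p)
    (hL : ∀ j, 0 < L j) (hT : 0 < T) (h₀ : MemH p L θ₀ θ₀') (j : Fin 3) :
    IsPrimitive (L j) (θ j 0) (θ₀' j) :=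
  (h₀.1 j).2.2.isPrimitive (hL j) (MemLp.integrable_of_ofReal hp (h₀.1 j).2.1)
    (h.continuousOn_slice j ⟨le_rfl, hT.le⟩) (h.initial j)

/-- The rate of change of the energy is the squared `L²` norm of the velocity. -/
theorem ae_sum_integral_mul_time (h : IsWeakSolution p L T θ₀ θ θs θt lam mu)
    (hL : ∀ j, 0 < L j) (hT : 0 < T)
    (hw : ∀ j, ∀ᵐ t ∂(leb T),
      IsRegularSlice p (L j) (coeff (lam t) (mu t) j 0) (coeff (lam t) (mu t) j 1)
        (θ j t) (θs j t) (θt j t) (w j t)) :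
    ∀ᵐ t ∂(leb T), ∑ j, ∫ s, w j t s * θt j t s ∂(leb (L j))
      = ∑ j, ∫ s, θt j t s ^ 2 ∂(leb (L j)) := by
  filter_upwards [ae_all_iff.2 hw, ae_all_iff.2 fun j => h.ae_integral_time_eq hT j 0]
    with t h1 h2
  simp_rw [fun j => (h1 j).integral_w_mul_time (hL j).le, fun j => (h2 j).1, fun j => (h2 j).2]
  rw [Finset.sum_sub_distrib, Finset.sum_add_distrib, ← Finset.sum_mul, ← Finset.sum_mul,
    sum_coeff, sum_coeff]
  ring

/-- The energy inequality over one backward time step. -/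
theorem ae_step_le (h : IsWeakSolution p L T θ₀ θ θs θt lam mu) (hp : 1 < p)
    (hL : ∀ j, 0 < L j) (hT : 0 < T) (h₀ : MemH p L θ₀ θ₀')
    (hw : ∀ j, ∀ᵐ t ∂(leb T),
      IsRegularSlice p (L j) (coeff (lam t) (mu t) j 0) (coeff (lam t) (mu t) j 1)
        (θ j t) (θs j t) (θt j t) (w j t))
    {F : ℝ → ℝ} (hF : ∀ t, 0 < t → F t = ∑ j, ∫ s, |θs j t s| ^ p ∂(leb (L j)))
    (hF0 : ∀ t ≤ 0, F t = ∑ j, ∫ s, |θ₀' j s| ^ p ∂(leb (L j))) (n : ℕ) :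
    ∀ᵐ t ∂(leb T), (n + 1) * (F t - F (t - 1 / (n + 1)))
      ≤ -p * ∑ j, ∫ s, w j t s * diffQuot (fun t => θ j t s) n t ∂(leb (L j)) := by
  have hgood := ae_leb_iff.1 (ae_all_iff.2 hw)
  -- Translations preserve null sets, so for almost every `t` the earlier time is regular as well,
  -- whenever it lies in `(0, T)`.
  have hshift := (measurePreserving_sub_right (volume : Measure ℝ)
    (1 / ((n : ℝ) + 1))).quasiMeasurePreserving.ae hgood
  rw [ae_leb_iff]
  filter_upwards [hgood, hshift] with t h1 h2 ht
  have hn : (0 : ℝ) < 1 / (n + 1) := by positivity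
  specialize h1 ht
  -- The competitor is the slice one step earlier, or the initial datum when the step reaches below
  -- time `0`.
  obtain ⟨ψ, hψ, hψp, hFψ⟩ : ∃ ψ : Fin 3 → ℝ → ℝ,
      (∀ j, IsPrimitive (L j) (θ j (max (t - 1 / (n + 1)) 0)) (ψ j)) ∧
      (∀ j, MemLp (ψ j) (ENNReal.ofReal p) (leb (L j))) ∧
      F (t - 1 / (n + 1)) = ∑ j, ∫ s, |ψ j s| ^ p ∂(leb (L j)) := by
    rcases le_or_gt (t - 1 / (n + 1)) 0 with h0 | h0
    · rw [max_eq_right h0]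
      exact ⟨θ₀', fun j => h.isPrimitive_initial hp hL hT h₀ j, fun j => (h₀.1 j).2.1, hF0 _ h0⟩
    · rw [max_eq_left h0.le]
      have h3 := h2 ⟨h0, by linarith [ht.2]⟩
      exact ⟨fun j => θs j _, fun j => (h3 j).isPrimitive, fun j => (h3 j).memLp, hF _ h0⟩
  have hstep : F t - F (t - 1 / (n + 1))
      ≤ -p * ∑ j, ∫ s, w j t s * (θ j t s - θ j (max (t - 1 / (n + 1)) 0) s) ∂(leb (L j)) := by
    rw [hF t ht.1, hFψ, ← Finset.sum_sub_distrib, Finset.mul_sum]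
    exact Finset.sum_le_sum fun j _ =>
      (h1 j).integral_rpow_sub_le hp (hL j).le (hψ j) (hψp j)
  have hq : ∀ j, ∫ s, w j t s * diffQuot (fun t => θ j t s) n t ∂(leb (L j)) = (n + 1) *
      ∫ s, w j t s * (θ j t s - θ j (max (t - 1 / (n + 1)) 0) s) ∂(leb (L j)) := fun j => by
    rw [← integral_const_mul]
    congr 1; ext s; simp only [diffQuot]; ring
  simp_rw [hq, ← Finset.mul_sum]
  calc _ ≤ ((n : ℝ) + 1) * (-p * _) := mul_le_mul_of_nonneg_left hstep (by positivity)
    _ = _ := by ring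

/-- The energy never exceeds its initial value. -/
theorem ae_sum_integral_rpow_le (h : IsWeakSolution p L T θ₀ θ θs θt lam mu) (hp : 1 < p)
    (hL : ∀ j, 0 < L j) (hT : 0 < T) (h₀ : MemH p L θ₀ θ₀') :
    ∀ᵐ t ∂(leb T), ∑ j, ∫ s, |θs j t s| ^ p ∂(leb (L j))
      ≤ ∑ j, ∫ s, |θ₀' j s| ^ p ∂(leb (L j)) := by
  choose w hw2 hw using fun j => h.exists_isRegularSlice hp hL j
  set f : ℝ → ℝ := fun t => ∑ j, ∫ s, |θs j t s| ^ p ∂(leb (L j)) with hf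
  set E := ∑ j, ∫ s, |θ₀' j s| ^ p ∂(leb (L j))
  have hfi : Integrable f (leb T) :=
    integrable_finsetSum _ fun j _ => (h.memLinftyW1p j).2.1.integrable_integral_rpow hp
  have hP : IsPrimitive T (fun x => ∫ t in (0 : ℝ)..x, f t) f :=
    ⟨(intervalIntegrable_iff_leb hT.le).2 hfi, fun x _ => by simp⟩
  -- Work at a time `τ` at which the averages of the energy `f` over `(τ - h, τ)` converge to `f τ`.
  filter_upwards [hP.ae_tendsto_diffQuot hT.le, ae_mem_Ioo_leb T] with τ hτlim hτ
  have hfτ : IntervalIntegrable f volume 0 τ := (hP.mono hτ.1.le hτ.2.le).intervalIntegrable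
  -- Extending by the initial energy `E` makes the telescoped integral, divided by the step, exactly
  -- the average of `f` over the last step minus `E`.
  set F : ℝ → ℝ := fun t => if t ≤ 0 then E else f t with hF
  have hFpos : ∀ t, 0 < t → F t = f t := fun t ht => by simp [hF, not_le.2 ht]
  have hFneg : ∀ t ≤ 0, F t = E := fun t ht => by simp [hF, ht]
  have hF0 : ∀ h, 0 ≤ h → IntervalIntegrable F volume (-h) 0 := fun h hh => by
    refine (intervalIntegrable_const (c := E)).congr fun t ht => ?_
    rw [uIoc_of_le (by linarith)] at ht
    exact (hFneg t ht.2).symm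
  have hF1 : IntervalIntegrable F volume 0 τ := hfτ.congr fun t ht => by
    rw [uIoc_of_le hτ.1.le] at ht
    exact (hFpos t ht.1).symm
  have hlim := fun j => tendsto_integral_integral_mul_diffQuot hτ.1.le
    (b := L j) (u := θ j) (g := θt j) (w := w j)
    ((h.continuousOn j).mono (prod_mono (Icc_subset_Icc_right hτ.2.le) subset_rfl))
    (((h.memH1L2 j).ae_isPrimitive hT (h.continuousOn j)).mono fun s hs =>
      hs.mono hτ.1.le hτ.2.le)
    (MemLp.mono_measure (leb_prod_leb_mono hτ.2.le) (h.memH1L2 j).2.1)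
    (MemLp.mono_measure (leb_prod_leb_mono hτ.2.le) (hw2 j))
  have hbound : ∀ᶠ n : ℕ in atTop, diffQuot (fun x => ∫ t in (0 : ℝ)..x, f t) n τ - E
      ≤ -p * ∑ j, ∫ t, ∫ s, w j t s * diffQuot (fun t => θ j t s) n t ∂(leb (L j)) ∂(leb τ) := by
    -- Only steps shorter than `τ` are considered, so the last step stays in positive time.
    filter_upwards [(tendsto_one_div_add_atTop_nhds_zero_nat (𝕜 := ℝ)).eventually_lt_const hτ.1]
      with n hn
    have hn0 : (0 : ℝ) < 1 / (n + 1) := by positivity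
    have hFi := (hF0 _ hn0.le).trans hF1
    have hstep := ae_restrict_of_ae_restrict_of_subset (Ioo_subset_Ioo_right hτ.2.le)
      (h.ae_step_le hp hL hT h₀ hw hFpos hFneg n)
    have hInt : ∀ j, Integrable (fun t =>
        ∫ s, w j t s * diffQuot (fun t => θ j t s) n t ∂(leb (L j))) (leb τ) := fun j =>
      ((hlim j).1 n).integral_prod_left
    have hFs : IntervalIntegrable (fun t => F (t - 1 / (n + 1))) volume 0 τ := by
      have := (hFi.mono_set (c := -(1 / (n + 1))) (d := τ - 1 / (n + 1)) (by
        rw [uIcc_of_le (by linarith [hτ.1]), uIcc_of_le (by linarith [hτ.1])]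
        exact Icc_subset_Icc_right (by linarith))).comp_sub_right (1 / (n + 1))
      simpa using this
    have hle := integral_mono_ae
      (((intervalIntegrable_iff_leb hτ.1.le).1 (hF1.sub hFs)).const_mul _)
      ((integrable_finsetSum _ fun j _ => hInt j).const_mul _) hstep
    rw [integral_const_mul, integral_const_mul, integral_finsetSum _ fun j _ => hInt j,
      integral_leb hτ.1.le, integral_sub_comp_sub hτ.1.le hn0.le hFi] at hle
    refine le_trans (le_of_eq ?_) hle
    have e1 : ∫ t in (-(1 / ((n : ℝ) + 1)))..0, F t = 1 / (n + 1) * E := by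
      have : ∫ t in (-(1 / ((n : ℝ) + 1)))..0, F t = ∫ t in (-(1 / ((n : ℝ) + 1)))..0, E := by
        refine intervalIntegral.integral_congr fun t ht => ?_
        rw [uIcc_of_le (by linarith)] at ht
        exact hFneg t ht.2
      rw [this]; simp
    have e2 : ∫ t in (τ - 1 / (n + 1))..τ, F t = ∫ t in (τ - 1 / (n + 1))..τ, f t := by
      refine intervalIntegral.integral_congr fun t ht => hFpos t ?_
      rw [uIcc_of_le (by linarith)] at ht
      linarith [ht.1]
    have e3 := intervalIntegral.integral_interval_sub_left hfτ
      (hfτ.mono_set (c := 0) (d := τ - 1 / (n + 1)) (by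
        rw [uIcc_of_le (by linarith), uIcc_of_le hτ.1.le]
        exact Icc_subset_Icc_right (by linarith)))
    rw [e1, e2, diffQuot, max_eq_left (by linarith), e3]
    have : (n : ℝ) + 1 ≠ 0 := by positivity
    field_simp
  have hfinal := le_of_tendsto_of_tendsto (hτlim.sub_const E)
    ((tendsto_finsetSum Finset.univ fun j _ => (hlim j).2).const_mul (-p)) hbound
  -- The limit of the right-hand side is `-p` times the total dissipation up to time `τ`.
  have hnn : 0 ≤ ∑ j, ∫ t, ∫ s, w j t s * θt j t s ∂(leb (L j)) ∂(leb τ) := by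
    have hi : ∀ j, Integrable (fun t => ∫ s, w j t s * θt j t s ∂(leb (L j))) (leb τ) := fun j =>
      (Integrable.integral_prod_left (MemLp.integrable_mul (p := 2) (q := 2) (hw2 j)
        (h.memH1L2 j).2.1)).mono_measure (leb_mono hτ.2.le)
    rw [← integral_finsetSum _ fun j _ => hi j]
    refine integral_nonneg_of_ae ?_
    filter_upwards [ae_restrict_of_ae_restrict_of_subset (Ioo_subset_Ioo_right hτ.2.le)
      (h.ae_sum_integral_mul_time hL hT hw)] with t ht
    rw [ht]
    exact Finset.sum_nonneg fun j _ => integral_nonneg fun s => sq_nonneg _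
  have : p * ∑ j, ∫ t, ∫ s, w j t s * θt j t s ∂(leb (L j)) ∂(leb τ) ≥ 0 :=
    mul_nonneg (by linarith) hnn
  linarith

end IsWeakSolution

/-! ### Uniform coercivity of the matrices -/

theorem abs_le_add_rpow {p K : ℝ} (hp : 1 < p) (hK : 0 < K) (z : ℝ) :
    |z| ≤ K + K ^ (1 - p) * |z| ^ p := by
  have h0 : 0 ≤ K ^ (1 - p) * |z| ^ p := by positivity
  rcases le_or_gt |z| K with h | h
  · linarith
  · have hz : 0 < |z| := hK.trans h
    have h1 : |z| ^ (1 - p) ≤ K ^ (1 - p) :=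
      Real.rpow_le_rpow_of_nonpos hK h.le (by linarith)
    have h2 : |z| = |z| ^ (1 - p) * |z| ^ p := by
      rw [← Real.rpow_add hz]; simp
    have h3 := mul_le_mul_of_nonneg_right h1 (Real.rpow_nonneg hz.le p)
    linarith

/-- A modulus of continuity depending on the energy bound only. The free parameter `K` stands in for
Hölder's inequality: a large `K` makes the second term small, and then a small `|x - y|` the first.
-/
theorem IsPrimitive.abs_sub_le {p b E K : ℝ} {ϑ ϑ' : ℝ → ℝ} (h : IsPrimitive b ϑ ϑ')
    (hp : 1 < p) (hb : 0 ≤ b) (hK : 0 < K) (hϑ' : MemLp ϑ' (ENNReal.ofReal p) (leb b))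
    (hE : ∫ s, |ϑ' s| ^ p ∂(leb b) ≤ E) {x y : ℝ} (hx : x ∈ Icc 0 b) (hy : y ∈ Icc 0 b) :
    |ϑ x - ϑ y| ≤ K * |x - y| + K ^ (1 - p) * E := by
  wlog hxy : y ≤ x generalizing x y
  · rw [abs_sub_comm, abs_sub_comm x y]; exact this hy hx (le_of_not_ge hxy)
  have hi : IntervalIntegrable (fun s => |ϑ' s| ^ p) volume 0 b :=
    (intervalIntegrable_iff_leb hb).2 (MemLp.integrable_abs_rpow hp hϑ')
  have hsub : uIcc y x ⊆ uIcc 0 b := by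
    rw [uIcc_of_le hb]; exact (convex_Icc 0 b).ordConnected.uIcc_subset hy hx
  have hi' := hi.mono_set hsub
  rw [h.sub_eq_integral hb hy hx, abs_of_nonneg (sub_nonneg.2 hxy)]
  calc |∫ s in y..x, ϑ' s| ≤ ∫ s in y..x, |ϑ' s| := intervalIntegral.abs_integral_le_integral_abs hxy
    _ ≤ ∫ s in y..x, (K + K ^ (1 - p) * |ϑ' s| ^ p) :=
      intervalIntegral.integral_mono_on hxy (h.intervalIntegrable.mono_set hsub).abs
        (intervalIntegrable_const.add (hi'.const_mul _)) fun s _ => abs_le_add_rpow hp hK _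
    _ = K * (x - y) + K ^ (1 - p) * ∫ s in y..x, |ϑ' s| ^ p := by
      rw [intervalIntegral.integral_add intervalIntegrable_const (hi'.const_mul _),
        intervalIntegral.integral_const_mul]
      simp [mul_comm]
    _ ≤ K * (x - y) + K ^ (1 - p) * E := by
      gcongr
      refine le_trans ?_ hE
      rw [integral_leb hb]
      exact intervalIntegral.integral_mono_interval hy.1 hxy hx.2
        (ae_of_all _ fun s => Real.rpow_nonneg (abs_nonneg _) _) hi

theorem mul_sub_le_integral {b c d a : ℝ} {g : ℝ → ℝ} (hg : ContinuousOn g (Icc 0 b))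
    (hg0 : ∀ s, 0 ≤ g s) (hc : 0 ≤ c) (hcd : c ≤ d) (hd : d ≤ b)
    (ha : ∀ s ∈ Icc c d, a ≤ g s) : a * (d - c) ≤ ∫ s, g s ∂(leb b) := by
  have hb : 0 ≤ b := hc.trans (hcd.trans hd)
  rw [integral_leb hb]
  calc a * (d - c) = ∫ _ in c..d, a := by simp [mul_comm]
    _ ≤ ∫ s in c..d, g s := intervalIntegral.integral_mono_on hcd (by simp)
        ((hg.mono (Icc_subset_Icc hc hd)).intervalIntegrable_of_Icc hcd) ha
    _ ≤ ∫ s in (0 : ℝ)..b, g s := intervalIntegral.integral_mono_interval hc hcd hd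
        (ae_of_all _ hg0) (hg.intervalIntegrable_of_Icc hb)

/-- A curve whose end points are not too far apart is not close to a straight line. -/
theorem exists_le_sq_of_sq_integral_le {b ℓ : ℝ} (hℓ : 0 ≤ ℓ) (hb : ℓ < b) {ϑ : ℝ → ℝ}
    (hϑ : ContinuousOn ϑ (Icc 0 b))
    (h : (∫ s, Real.cos (ϑ s) ∂(leb b)) ^ 2 + (∫ s, Real.sin (ϑ s) ∂(leb b)) ^ 2 ≤ ℓ ^ 2)
    (ξ₀ ξ₁ : ℝ) : ∃ x ∈ Icc 0 b, (1 - ℓ / b) / 2 * (ξ₀ ^ 2 + ξ₁ ^ 2)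
      ≤ (ξ₀ * Real.sin (ϑ x) - ξ₁ * Real.cos (ϑ x)) ^ 2 := by
  have hb0 : 0 < b := hℓ.trans_lt hb
  set δ := (1 - ℓ / b) / 2 with hδ
  have hδb : (1 - δ) * b = (b + ℓ) / 2 := by rw [hδ]; field_simp; ring
  have hδ1 : 0 < 1 - δ := by
    have : 0 ≤ ℓ / b := by positivity
    rw [hδ]; linarith
  -- Otherwise `r`, the component of the tangent along `ξ` times `ρ = |ξ|`, satisfies `r² ≥ (1 - δ)
  -- ρ²`, and `|r| ≤ ρ` improves this to `|r| ≥ (1 - δ) ρ`. By continuity `r` keeps its sign, so `|∫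
  -- r| ≥ (1 - δ) ρ b = ρ (b + ℓ) / 2`. This exceeds `ρ ℓ`, the most that the chord allows.
  by_contra! hcon
  set ρ := √(ξ₀ ^ 2 + ξ₁ ^ 2) with hρ
  have hρ2 : ρ ^ 2 = ξ₀ ^ 2 + ξ₁ ^ 2 := Real.sq_sqrt (by positivity)
  have hρ0 : 0 < ρ := by
    refine lt_of_le_of_ne (Real.sqrt_nonneg _) fun h0 => ?_
    have h1 := hcon 0 ⟨le_rfl, hb0.le⟩
    rw [← hρ2, ← h0] at h1
    nlinarith [sq_nonneg (ξ₀ * Real.sin (ϑ 0) - ξ₁ * Real.cos (ϑ 0))]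
  set r : ℝ → ℝ := fun s => ξ₀ * Real.cos (ϑ s) + ξ₁ * Real.sin (ϑ s) with hr
  have hcc : ContinuousOn (fun s => Real.cos (ϑ s)) (Icc 0 b) :=
    Real.continuous_cos.comp_continuousOn hϑ
  have hcs : ContinuousOn (fun s => Real.sin (ϑ s)) (Icc 0 b) :=
    Real.continuous_sin.comp_continuousOn hϑ
  have hrc : ContinuousOn r (Icc 0 b) :=
    (continuousOn_const.mul hcc).add (continuousOn_const.mul hcs)
  have hid : ∀ s, (ξ₀ * Real.sin (ϑ s) - ξ₁ * Real.cos (ϑ s)) ^ 2 + r s ^ 2 = ρ ^ 2 := fun s => by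
    rw [hρ2]
    have := Real.sin_sq_add_cos_sq (ϑ s)
    simp only [hr]
    linear_combination (ξ₀ ^ 2 + ξ₁ ^ 2) * this
  have hrabs : ∀ s ∈ Icc 0 b, (1 - δ) * ρ ≤ |r s| := by
    intro s hs
    have h1 := hcon s hs
    have h2 := hid s
    rw [← hρ2] at h1
    have h3 : |r s| ≤ ρ := abs_le_of_sq_le_sq 
      (by linarith [sq_nonneg (ξ₀ * Real.sin (ϑ s) - ξ₁ * Real.cos (ϑ s))]) hρ0.le
    have h4 : (1 - δ) * ρ * ρ ≤ |r s| * ρ := by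
      nlinarith [abs_nonneg (r s), sq_abs (r s)]
    exact le_of_mul_le_mul_right h4 hρ0
  have hpos : 0 < (1 - δ) * ρ := mul_pos hδ1 hρ0
  have hri : |∫ s, r s ∂(leb b)| ≤ ρ * ℓ := by
    have e : ∫ s, r s ∂(leb b)
        = ξ₀ * ∫ s, Real.cos (ϑ s) ∂(leb b) + ξ₁ * ∫ s, Real.sin (ϑ s) ∂(leb b) := by
      rw [← integral_const_mul, ← integral_const_mul, ← integral_add
        ((integrable_of_continuousOn hcc).const_mul _) ((integrable_of_continuousOn hcs).const_mul _)]
    rw [e]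
    refine abs_le_of_sq_le_sq ?_ (by positivity)
    rw [mul_pow, hρ2]
    set X := ∫ s, Real.cos (ϑ s) ∂(leb b)
    set Y := ∫ s, Real.sin (ϑ s) ∂(leb b)
    calc (ξ₀ * X + ξ₁ * Y) ^ 2 ≤ (ξ₀ ^ 2 + ξ₁ ^ 2) * (X ^ 2 + Y ^ 2) := by
          nlinarith [sq_nonneg (ξ₀ * Y - ξ₁ * X)]
      _ ≤ _ := by gcongr
  have hrI : ∀ c : ℝ, ∫ _, c ∂(leb b) = c * b := fun c => by
    rw [integral_leb hb0.le]; simp [mul_comm]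
  have hri' := integrable_of_continuousOn hrc
  have hbig : (1 - δ) * ρ * b ≤ |∫ s, r s ∂(leb b)| := by
    by_cases hsign : ∀ s ∈ Icc 0 b, 0 < r s
    · refine le_trans ?_ (le_abs_self _)
      rw [← hrI]
      refine integral_mono_ae (integrable_const _) hri' ?_
      filter_upwards [ae_mem_Ioo_leb b] with s hs
      have hs' := Ioo_subset_Icc_self hs
      exact (hrabs s hs').trans_eq (abs_of_pos (hsign s hs'))
    · push Not at hsign
      obtain ⟨y, hy, hy0⟩ := hsign
      have hneg : ∀ s ∈ Icc 0 b, r s ≤ 0 := by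
        intro s hs
        by_contra! hs0
        obtain ⟨z, hz, hz0⟩ := isPreconnected_Icc.intermediate_value hy hs hrc ⟨hy0, hs0.le⟩
        have := hrabs z hz
        rw [hz0, abs_zero] at this
        linarith
      refine le_trans ?_ (neg_le_abs _)
      rw [← hrI, ← integral_neg]
      refine integral_mono_ae (integrable_const _) hri'.neg ?_
      filter_upwards [ae_mem_Ioo_leb b] with s hs
      have hs' := Ioo_subset_Icc_self hs
      exact (hrabs s hs').trans_eq (abs_of_nonpos (hneg s hs'))
  have : ρ * ((b + ℓ) / 2) ≤ ρ * ℓ := by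
    rw [← hδb]; linarith
  have := le_of_mul_le_mul_left this hρ0
  linarith

/-- Uniform ellipticity of the matrices `A(θ)` on sets of bounded energy. -/
theorem exists_coercive {p b ℓ : ℝ} (hp : 1 < p) (hℓ : 0 ≤ ℓ) (hb : ℓ < b) (E : ℝ) :
    ∃ c : ℝ, 0 < c ∧ ∀ ϑ ϑ' : ℝ → ℝ, IsPrimitive b ϑ ϑ' →
      MemLp ϑ' (ENNReal.ofReal p) (leb b) → ∫ s, |ϑ' s| ^ p ∂(leb b) ≤ E →
      (∫ s, Real.cos (ϑ s) ∂(leb b)) ^ 2 + (∫ s, Real.sin (ϑ s) ∂(leb b)) ^ 2 ≤ ℓ ^ 2 →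
      ∀ ξ₀ ξ₁ : ℝ, c * (ξ₀ ^ 2 + ξ₁ ^ 2)
        ≤ ∫ s, (ξ₀ * Real.sin (ϑ s) - ξ₁ * Real.cos (ϑ s)) ^ 2 ∂(leb b) := by
  have hb0 : 0 < b := hℓ.trans_lt hb
  set δ := (1 - ℓ / b) / 2 with hδ
  have hδ0 : 0 < δ := by
    have : ℓ / b < 1 := (div_lt_one hb0).2 hb
    rw [hδ]; linarith
  have hδ1 : δ ≤ 1 := by
    have : 0 ≤ ℓ / b := by positivity
    rw [hδ]; linarith
  -- `K` and then `m` are chosen so that `ϑ` varies by at most `δ / 4` within distance `m`. There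
  -- `q` loses at most `ρ δ / 2` of its size `|q x₀| ≥ δ ρ`, so `q² ≥ δ² ρ² / 4`.
  obtain ⟨K, hK, hK0⟩ : ∃ K : ℝ, K ^ (1 - p) * E < δ / 8 ∧ 0 < K := by
    have h1 : Tendsto (fun K : ℝ => K ^ (1 - p) * E) atTop (𝓝 0) := by
      have := (tendsto_rpow_neg_atTop (sub_pos.2 hp)).mul_const E
      simpa using this
    exact ((h1.eventually_lt_const (by positivity)).and (eventually_gt_atTop 0)).exists
  set m := min (δ / (8 * K)) (b / 2) with hm
  have hm0 : 0 < m := lt_min (by positivity) (by positivity)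
  have hmK : K * m ≤ δ / 8 := by
    calc K * m ≤ K * (δ / (8 * K)) := mul_le_mul_of_nonneg_left (min_le_left _ _) hK0.le
      _ = δ / 8 := by field_simp
  have hmb : m ≤ b / 2 := min_le_right _ _
  refine ⟨δ ^ 2 / 4 * m, by positivity, fun ϑ ϑ' hϑ hϑ' hE hcl ξ₀ ξ₁ => ?_⟩
  have hc := hϑ.continuousOn hb0.le
  obtain ⟨x₀, hx₀, hq⟩ := exists_le_sq_of_sq_integral_le hℓ hb hc hcl ξ₀ ξ₁
  set q : ℝ → ℝ := fun s => ξ₀ * Real.sin (ϑ s) - ξ₁ * Real.cos (ϑ s) with hqdef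
  set ρ := √(ξ₀ ^ 2 + ξ₁ ^ 2) with hρ
  have hρ2 : ρ ^ 2 = ξ₀ ^ 2 + ξ₁ ^ 2 := Real.sq_sqrt (by positivity)
  have hρ0 : 0 ≤ ρ := Real.sqrt_nonneg _
  have hq0 : δ * ρ ≤ |q x₀| := by
    refine abs_le_of_sq_le_sq' ?_ (abs_nonneg _) |>.2
    rw [sq_abs, mul_pow, hρ2]
    refine le_trans ?_ hq
    gcongr
    nlinarith
  have hnear : ∀ x ∈ Icc 0 b, |x - x₀| ≤ m → δ ^ 2 / 4 * (ξ₀ ^ 2 + ξ₁ ^ 2) ≤ q x ^ 2 := by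
    intro x hx hxm
    have h1 := hϑ.abs_sub_le hp hb0.le hK0 hϑ' hE hx hx₀
    have h2 : |ϑ x - ϑ x₀| ≤ δ / 4 := by
      have := mul_le_mul_of_nonneg_left hxm hK0.le
      linarith
    have hξ0 : |ξ₀| ≤ ρ := Real.abs_le_sqrt (by linarith [sq_nonneg ξ₁])
    have hξ1 : |ξ₁| ≤ ρ := Real.abs_le_sqrt (by linarith [sq_nonneg ξ₀])
    have hs : |Real.sin (ϑ x) - Real.sin (ϑ x₀)| ≤ δ / 4 := by
      have := Real.lipschitzWith_sin.dist_le_mul (ϑ x) (ϑ x₀)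
      simp only [Real.dist_eq, NNReal.coe_one, one_mul] at this
      exact this.trans h2
    have hcs : |Real.cos (ϑ x) - Real.cos (ϑ x₀)| ≤ δ / 4 := by
      have := Real.lipschitzWith_cos.dist_le_mul (ϑ x) (ϑ x₀)
      simp only [Real.dist_eq, NNReal.coe_one, one_mul] at this
      exact this.trans h2
    have h3 : |q x - q x₀| ≤ ρ * (δ / 4) + ρ * (δ / 4) := by
      have e : q x - q x₀ = ξ₀ * (Real.sin (ϑ x) - Real.sin (ϑ x₀))
          - ξ₁ * (Real.cos (ϑ x) - Real.cos (ϑ x₀)) := by simp only [hqdef]; ring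
      rw [e]
      refine (norm_sub_le (_ : ℝ) _).trans ?_
      rw [Real.norm_eq_abs, Real.norm_eq_abs, abs_mul, abs_mul]
      gcongr
    have h4 : |q x₀| - |q x| ≤ |q x - q x₀| := by
      exact (abs_sub_abs_le_abs_sub _ _).trans_eq (abs_sub_comm _ _)
    have h5 : δ / 2 * ρ ≤ |q x| := by linarith
    calc δ ^ 2 / 4 * (ξ₀ ^ 2 + ξ₁ ^ 2) = (δ / 2 * ρ) ^ 2 := by rw [mul_pow, hρ2]; ring
      _ ≤ |q x| ^ 2 := by gcongr
      _ = q x ^ 2 := sq_abs _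
  have hqc : ContinuousOn (fun s => q s ^ 2) (Icc 0 b) :=
    ((continuousOn_const.mul (Real.continuous_sin.comp_continuousOn hc)).sub
      (continuousOn_const.mul (Real.continuous_cos.comp_continuousOn hc))).pow 2
  have hfin : δ ^ 2 / 4 * m * (ξ₀ ^ 2 + ξ₁ ^ 2) = δ ^ 2 / 4 * (ξ₀ ^ 2 + ξ₁ ^ 2) * m := by ring
  rw [hfin]
  -- As `m ≤ b / 2`, an interval of length `m` starting or ending at `x₀` fits into `[0, b]`.
  rcases le_total x₀ (b / 2) with hx | hx
  · have := mul_sub_le_integral hqc (fun _ => sq_nonneg _) hx₀.1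
      (by linarith : x₀ ≤ x₀ + m) (by linarith) fun s hs => hnear s
        ⟨hx₀.1.trans hs.1, by linarith [hs.2]⟩ (by rw [abs_of_nonneg] <;> linarith [hs.1, hs.2])
    simpa using this
  · have := mul_sub_le_integral hqc (fun _ => sq_nonneg _) (by linarith)
      (by linarith : x₀ - m ≤ x₀) hx₀.2 fun s hs => hnear s
        ⟨by linarith [hs.1], hs.2.trans hx₀.2⟩ (by rw [abs_of_nonpos] <;> linarith [hs.1, hs.2])
    simpa using this

/-! ### The linear system and the bound for the multipliers -/

theorem vecMul_matA_dotProduct {b : ℝ} {ϑ : ℝ → ℝ} (hϑ : ContinuousOn ϑ (Icc 0 b))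
    (ξ : Fin 2 → ℝ) : (ξ ᵥ* matA b ϑ) ⬝ᵥ ξ
      = ∫ s, (ξ 0 * Real.sin (ϑ s) - ξ 1 * Real.cos (ϑ s)) ^ 2 ∂(leb b) := by
  have hc := Real.continuous_cos.comp_continuousOn hϑ
  have hs := Real.continuous_sin.comp_continuousOn hϑ
  have e : ∀ s, (ξ 0 * Real.sin (ϑ s) - ξ 1 * Real.cos (ϑ s)) ^ 2
      = ξ 0 ^ 2 * Real.sin (ϑ s) ^ 2 - 2 * ξ 0 * ξ 1 * (Real.sin (ϑ s) * Real.cos (ϑ s))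
        + ξ 1 ^ 2 * Real.cos (ϑ s) ^ 2 := fun s => by ring
  have i1 : Integrable (fun s => ξ 0 ^ 2 * Real.sin (ϑ s) ^ 2) (leb b) :=
    (integrable_of_continuousOn (hs.pow 2)).const_mul _
  have i2 : Integrable (fun s => 2 * ξ 0 * ξ 1 * (Real.sin (ϑ s) * Real.cos (ϑ s))) (leb b) :=
    (integrable_of_continuousOn (hs.mul hc)).const_mul _
  have i3 : Integrable (fun s => ξ 1 ^ 2 * Real.cos (ϑ s) ^ 2) (leb b) :=
    (integrable_of_continuousOn (hc.pow 2)).const_mul _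
  have i12 : Integrable (fun s => ξ 0 ^ 2 * Real.sin (ϑ s) ^ 2
    - 2 * ξ 0 * ξ 1 * (Real.sin (ϑ s) * Real.cos (ϑ s))) (leb b) := i1.sub i2
  simp_rw [e]
  rw [integral_add i12 i3, integral_sub i1 i2, integral_const_mul, integral_const_mul,
    integral_const_mul]
  simp [matA, Matrix.vecMul, dotProduct, Fin.sum_univ_two]
  ring

theorem abs_vecG_le {p b : ℝ} {ϑ ϑ' : ℝ → ℝ} (hp : 1 < p)
    (hϑ' : MemLp ϑ' (ENNReal.ofReal p) (leb b)) (i : Fin 2) :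
    |vecG p b ϑ ϑ' i| ≤ ∫ s, |ϑ' s| ^ p ∂(leb b) := by
  have key : ∀ g : ℝ → ℝ, (∀ s, |g s| ≤ 1) →
      |∫ s, |ϑ' s| ^ p * g s ∂(leb b)| ≤ ∫ s, |ϑ' s| ^ p ∂(leb b) := fun g hg => by
    rw [← Real.norm_eq_abs]
    refine norm_integral_le_of_norm_le (MemLp.integrable_abs_rpow hp hϑ') (ae_of_all _ fun s => ?_)
    have h0 : 0 ≤ |ϑ' s| ^ p := by positivity
    rw [Real.norm_eq_abs, abs_mul, abs_of_nonneg h0]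
    exact mul_le_of_le_one_right h0 (hg s)
  fin_cases i
  · exact key _ fun s => Real.abs_cos_le_one _
  · exact key _ fun s => Real.abs_sin_le_one _

/-- Applied to the shortest curve, it bounds the chord common to all three curves. -/
theorem sq_integral_cos_add_sq_integral_sin_le {b : ℝ} (hb : 0 ≤ b) {ϑ : ℝ → ℝ}
    (hϑ : ContinuousOn ϑ (Icc 0 b)) :
    (∫ s, Real.cos (ϑ s) ∂(leb b)) ^ 2 + (∫ s, Real.sin (ϑ s) ∂(leb b)) ^ 2 ≤ b ^ 2 := by
  have hc : ContinuousOn (fun s => Real.cos (ϑ s)) (Icc 0 b) :=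
    Real.continuous_cos.comp_continuousOn hϑ
  have hs : ContinuousOn (fun s => Real.sin (ϑ s)) (Icc 0 b) :=
    Real.continuous_sin.comp_continuousOn hϑ
  have h1 := sq_integral_le hb (hc.intervalIntegrable_of_Icc hb)
    ((hc.pow 2).intervalIntegrable_of_Icc hb)
  have h2 := sq_integral_le hb (hs.intervalIntegrable_of_Icc hb)
    ((hs.pow 2).intervalIntegrable_of_Icc hb)
  have h3 : ∫ s in (0 : ℝ)..b, (Real.cos (ϑ s) ^ 2 + Real.sin (ϑ s) ^ 2)
      = (∫ s in (0 : ℝ)..b, Real.cos (ϑ s) ^ 2) + ∫ s in (0 : ℝ)..b, Real.sin (ϑ s) ^ 2 :=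
    intervalIntegral.integral_add ((hc.pow 2).intervalIntegrable_of_Icc hb)
      ((hs.pow 2).intervalIntegrable_of_Icc hb)
  simp only [Real.cos_sq_add_sin_sq, intervalIntegral.integral_const, smul_eq_mul, sub_zero,
    mul_one] at h1 h2 h3
  rw [integral_leb hb, integral_leb hb]
  nlinarith

/-- The linear system for the multipliers, solved by testing with the multipliers themselves. -/
theorem sum_abs_le_of_coercive {c E : ℝ} (hc : 0 < c) (κ G W : Fin 3 → Fin 2 → ℝ)
    (V : Fin 2 → ℝ) (hsum : ∀ i, ∑ j, κ j i = 0) (hGW : ∀ j, G j + W j = V)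
    (hG : ∀ j i, |G j i| ≤ E) (h0 : c * (κ 0 0 ^ 2 + κ 0 1 ^ 2) ≤ W 0 ⬝ᵥ κ 0)
    (h1 : c * (κ 1 0 ^ 2 + κ 1 1 ^ 2) ≤ W 1 ⬝ᵥ κ 1) (h2 : 0 ≤ W 2 ⬝ᵥ κ 2) :
    |κ 0 0| + |κ 0 1| + |κ 1 0| + |κ 1 1| ≤ 8 * E / c := by
  have hE : 0 ≤ E := (abs_nonneg _).trans (hG 0 0)
  set a := |κ 0 0| + |κ 0 1| + |κ 1 0| + |κ 1 1| with ha
  have hpt : ∀ j i, -(κ j i * G j i) ≤ |κ j i| * E := fun j i => by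
    refine (neg_le_abs _).trans ?_
    rw [abs_mul]; exact mul_le_mul_of_nonneg_left (hG j i) (abs_nonneg _)
  have hW : ∀ j i, W j i = V i - G j i := fun j i => by
    rw [← hGW j]; simp
  simp only [dotProduct, Fin.sum_univ_two, hW] at h0 h1 h2
  have s0 := hsum 0
  have s1 := hsum 1
  simp only [Fin.sum_univ_three] at s0 s1
  have b0 : |κ 2 0| ≤ |κ 0 0| + |κ 1 0| := by
    rw [show κ 2 0 = -(κ 0 0 + κ 1 0) by linarith, abs_neg]; exact abs_add_le _ _
  have b1 : |κ 2 1| ≤ |κ 0 1| + |κ 1 1| := by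
    rw [show κ 2 1 = -(κ 0 1 + κ 1 1) by linarith, abs_neg]; exact abs_add_le _ _
  have hV0 : V 0 * κ 0 0 + V 0 * κ 1 0 + V 0 * κ 2 0 = 0 := by
    rw [← mul_add, ← mul_add, s0, mul_zero]
  have hV1 : V 1 * κ 0 1 + V 1 * κ 1 1 + V 1 * κ 2 1 = 0 := by
    rw [← mul_add, ← mul_add, s1, mul_zero]
  -- Sum of the three pairings: `V` cancels, and `|κ₂|` is absorbed into `|κ₀| + |κ₁|`, which gives
  -- the factor `2`.
  have hmain : c * (κ 0 0 ^ 2 + κ 0 1 ^ 2 + κ 1 0 ^ 2 + κ 1 1 ^ 2) ≤ 2 * a * E := by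
    have b0' := mul_le_mul_of_nonneg_right b0 hE
    have b1' := mul_le_mul_of_nonneg_right b1 hE
    linarith [hpt 0 0, hpt 0 1, hpt 1 0, hpt 1 1, hpt 2 0, hpt 2 1]
  -- Cauchy-Schwarz for four terms. With `hmain` it yields `c a² / 4 ≤ 2 a E`, hence the constant
  -- `8`.
  have ha2 : a ^ 2 ≤ 4 * (κ 0 0 ^ 2 + κ 0 1 ^ 2 + κ 1 0 ^ 2 + κ 1 1 ^ 2) := by
    rw [← sq_abs (κ 0 0), ← sq_abs (κ 0 1), ← sq_abs (κ 1 0), ← sq_abs (κ 1 1), ha]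
    linarith [sq_nonneg (|κ 0 0| - |κ 0 1|), sq_nonneg (|κ 0 0| - |κ 1 0|),
      sq_nonneg (|κ 0 0| - |κ 1 1|), sq_nonneg (|κ 0 1| - |κ 1 0|),
      sq_nonneg (|κ 0 1| - |κ 1 1|), sq_nonneg (|κ 1 0| - |κ 1 1|)]
  have ha0 : 0 ≤ a := by positivity
  rw [le_div_iff₀ hc]
  rcases ha0.eq_or_lt with h | h
  · rw [← h]; simpa using hE
  · have : a * (a * c) ≤ a * (8 * E) := by
      have := mul_le_mul_of_nonneg_left ha2 hc.le
      linarith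
    exact le_of_mul_le_mul_left this h

theorem norm_le_abs_add_abs (x : EuclideanSpace ℝ (Fin 2)) : ‖x‖ ≤ |x 0| + |x 1| := by
  rw [EuclideanSpace.norm_eq, Fin.sum_univ_two, Real.norm_eq_abs, Real.norm_eq_abs]
  refine Real.sqrt_le_iff.2 ⟨by positivity, ?_⟩
  nlinarith [mul_nonneg (abs_nonneg (x 0)) (abs_nonneg (x 1))]

namespace IsWeakSolution

variable {p : ℝ} {L : Fin 3 → ℝ} {T : ℝ} {θ₀ θ₀' : Fin 3 → ℝ → ℝ}
  {θ θs θt : Fin 3 → ℝ → ℝ → ℝ} {lam mu : ℝ → EuclideanSpace ℝ (Fin 2)}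

/-- The common value `V` is the velocity of the shared end point. It is not estimated anywhere, only
eliminated. -/
theorem ae_exists_vecG_add_vecMul_eq (h : IsWeakSolution p L T θ₀ θ θs θt lam mu) (hp : 1 < p)
    (hL : ∀ j, 0 < L j) (hT : 0 < T) :
    ∀ᵐ t ∂(leb T), ∃ V, ∀ j, vecG p (L j) (θ j t) (θs j t)
      + (coeff (lam t) (mu t) j).ofLp ᵥ* matA (L j) (θ j t) = V := by
  choose w _ hw using fun j => h.exists_isRegularSlice hp hL j
  filter_upwards [ae_all_iff.2 hw, ae_all_iff.2 fun j => h.ae_integral_time_eq hT j 0]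
    with t h1 h2
  refine ⟨![-∫ s, θt 0 t s * Real.sin (θ 0 t s) ∂(leb (L 0)),
    ∫ s, θt 0 t s * Real.cos (θ 0 t s) ∂(leb (L 0))], fun j => ?_⟩
  have e : (coeff (lam t) (mu t) j).ofLp
      = ![coeff (lam t) (mu t) j 0, coeff (lam t) (mu t) j 1] := by
    ext i; fin_cases i <;> rfl
  rw [e, (h1 j).vecG_add_vecMul hp (hL j).le, (h2 j).1, (h2 j).2]

/-- The multipliers are bounded in terms of the energy of the initial datum. -/
theorem ae_norm_le (h : IsWeakSolution p L T θ₀ θ θs θt lam mu) (hp : 1 < p)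
    (hL : ∀ j, 0 < L j) (hT : 0 < T) (h₀ : MemH p L θ₀ θ₀') {E c : ℝ} (hc : 0 < c)
    (hE : ∑ j, ∫ s, |θ₀' j s| ^ p ∂(leb (L j)) = E)
    (hcoer : ∀ j, j ≠ 2 → ∀ ϑ ϑ' : ℝ → ℝ, IsPrimitive (L j) ϑ ϑ' →
      MemLp ϑ' (ENNReal.ofReal p) (leb (L j)) → ∫ s, |ϑ' s| ^ p ∂(leb (L j)) ≤ E →
      (∫ s, Real.cos (ϑ s) ∂(leb (L j))) ^ 2 + (∫ s, Real.sin (ϑ s) ∂(leb (L j))) ^ 2 ≤ L 2 ^ 2 →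
      ∀ ξ₀ ξ₁ : ℝ, c * (ξ₀ ^ 2 + ξ₁ ^ 2)
        ≤ ∫ s, (ξ₀ * Real.sin (ϑ s) - ξ₁ * Real.cos (ϑ s)) ^ 2 ∂(leb (L j))) :
    ∀ᵐ t ∂(leb T), ‖lam t‖ ≤ 8 * E / c ∧ ‖mu t‖ ≤ 8 * E / c := by
  choose w _ hw using fun j => h.exists_isRegularSlice hp hL j
  filter_upwards [ae_all_iff.2 hw, h.ae_exists_vecG_add_vecMul_eq hp hL hT,
    h.ae_sum_integral_rpow_le hp hL hT h₀, ae_mem_Ioo_leb T] with t h1 ⟨V, hV⟩ h3 ht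
  have htI := Ioo_subset_Icc_self ht
  have hEj : ∀ j, ∫ s, |θs j t s| ^ p ∂(leb (L j)) ≤ E := fun j => by
    rw [hE] at h3
    exact (Finset.single_le_sum (f := fun j => ∫ s, |θs j t s| ^ p ∂(leb (L j)))
      (fun j _ => integral_nonneg fun s => Real.rpow_nonneg (abs_nonneg _) _)
      (Finset.mem_univ j)).trans h3
  have hcl := sq_integral_cos_add_sq_integral_sin_le (hL 2).le (h.continuousOn_slice 2 htI)
  have hco : ∀ j, j ≠ 2 → c * (coeff (lam t) (mu t) j 0 ^ 2 + coeff (lam t) (mu t) j 1 ^ 2)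
      ≤ ((coeff (lam t) (mu t) j).ofLp ᵥ* matA (L j) (θ j t)) ⬝ᵥ
        (coeff (lam t) (mu t) j).ofLp := fun j hj => by
    rw [vecMul_matA_dotProduct (h.continuousOn_slice j htI)]
    have hjc := h.concurrent t htI j 2
    refine hcoer j hj _ _ (h1 j).isPrimitive (h1 j).memLp (hEj j) ?_ _ _
    rw [hjc.1, hjc.2]; exact hcl
  have hkey := sum_abs_le_of_coercive hc (fun j => (coeff (lam t) (mu t) j).ofLp)
    (fun j => vecG p (L j) (θ j t) (θs j t))
    (fun j => (coeff (lam t) (mu t) j).ofLp ᵥ* matA (L j) (θ j t)) V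
    (fun i => sum_coeff _ _ i) hV (fun j i => (abs_vecG_le hp (h1 j).memLp i).trans (hEj j))
    (hco 0 (by decide)) (hco 1 (by decide)) (by
      rw [vecMul_matA_dotProduct (h.continuousOn_slice 2 htI)]
      exact integral_nonneg fun s => sq_nonneg _)
  -- Both multipliers are recovered from the two coefficients on which the forms are coercive.
  have hmu : mu t = coeff (lam t) (mu t) 0 + coeff (lam t) (mu t) 1 := by simp [coeff]
  have hlam : lam t = coeff (lam t) (mu t) 1 := by simp [coeff]
  constructor
  · rw [hlam]
    refine (norm_le_abs_add_abs _).trans (le_trans ?_ hkey)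
    linarith [abs_nonneg (coeff (lam t) (mu t) 0 0), abs_nonneg (coeff (lam t) (mu t) 0 1)]
  · rw [hmu]
    refine (norm_add_le _ _).trans (le_trans (add_le_add (norm_le_abs_add_abs _)
      (norm_le_abs_add_abs _)) (le_trans (le_of_eq ?_) hkey))
    ring

end IsWeakSolution

end

end ThetaNetwork

/-! ### The proposition -/

open MeasureTheory in
open scoped Matrix in
theorem mainTheorem4 (p : ℝ) (hp : 1 < p) (L : Fin 3 → ℝ) (hL_pos : 0 < L 2)
    (hL : L 2 < min (L 0) (L 1)) :
    ∃ C : ℝ → ℝ, ∀ (θ₀ θ₀' : Fin 3 → ℝ → ℝ), ThetaNetwork.MemH p L θ₀ θ₀' →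
      ∀ T : ℝ, 0 < T →
      ∀ (θ θs θt : Fin 3 → ℝ → ℝ → ℝ) (lam mu : ℝ → EuclideanSpace ℝ (Fin 2)),
        ThetaNetwork.IsWeakSolution p L T θ₀ θ θs θt lam mu →
        (∀ᵐ t ∂(ThetaNetwork.leb T),
          (lam t).ofLp ᵥ* ThetaNetwork.matA (L 1) (θ 1 t)
              + (mu t).ofLp ᵥ* ThetaNetwork.matA (L 2) (θ 2 t)
            = ThetaNetwork.vecG p (L 2) (θ 2 t) (θs 2 t)
              - ThetaNetwork.vecG p (L 1) (θ 1 t) (θs 1 t) ∧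
          -((lam t).ofLp ᵥ* (ThetaNetwork.matA (L 1) (θ 1 t) + ThetaNetwork.matA (L 0) (θ 0 t)))
              + (mu t).ofLp ᵥ* ThetaNetwork.matA (L 0) (θ 0 t)
            = ThetaNetwork.vecG p (L 1) (θ 1 t) (θs 1 t)
              - ThetaNetwork.vecG p (L 0) (θ 0 t) (θs 0 t)) ∧
        eLpNorm lam ⊤ (ThetaNetwork.leb T) + eLpNorm mu ⊤ (ThetaNetwork.leb T)
          ≤ ENNReal.ofReal (C (ThetaNetwork.energy p L θ₀')) := by
  obtain ⟨hL0, hL1⟩ := lt_min_iff.1 hL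
  have hLj : ∀ j, 0 < L j := by
    intro j; fin_cases j
    · exact hL_pos.trans hL0
    · exact hL_pos.trans hL1
    · exact hL_pos
  -- The energy carries a factor `1 / p`, so `∑ ∫ |θ'|^p` is `p * D`. The coercivity constants are
  -- chosen for each `D` before any solution is given, which makes `C` independent of `T` and of the
  -- solution.
  choose c₀ hc₀ hcoer₀ using fun D : ℝ =>
    ThetaNetwork.exists_coercive hp hL_pos.le hL0 (p * D)
  choose c₁ hc₁ hcoer₁ using fun D : ℝ =>
    ThetaNetwork.exists_coercive hp hL_pos.le hL1 (p * D)
  refine ⟨fun D => 2 * (8 * (p * D) / min (c₀ D) (c₁ D)),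
    fun θ₀ θ₀' h₀ T hT θ θs θt lam mu h => ⟨?_, ?_⟩⟩
  · filter_upwards [h.ae_exists_vecG_add_vecMul_eq hp hLj hT] with t ⟨V, hV⟩
    have e0 := hV 0
    have e1 := hV 1
    have e2 := hV 2
    simp only [ThetaNetwork.coeff, Matrix.cons_val, WithLp.ofLp_neg,
      WithLp.ofLp_sub, Matrix.neg_vecMul, Matrix.sub_vecMul] at e0 e1 e2
    rw [Matrix.vecMul_add]
    constructor
    -- The two equations are the identities of curves `1` and `2`, and of curves `0` and `1`, with
    -- `V` eliminated.
    · rw [← e2, ← sub_eq_zero] at e1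
      rw [← sub_eq_zero, ← e1]; abel
    · rw [← e1, ← sub_eq_zero] at e0
      rw [← sub_eq_zero, ← e0]; abel
  · set D := ThetaNetwork.energy p L θ₀' with hD
    have hE : ∑ j, ∫ s, |θ₀' j s| ^ p ∂(ThetaNetwork.leb (L j)) = p * D := by
      rw [hD, ThetaNetwork.energy, ← mul_assoc, mul_one_div_cancel (by linarith), one_mul]
    have hE0 : 0 ≤ p * D := by
      rw [← hE]
      exact Finset.sum_nonneg fun j _ => integral_nonneg fun s =>
        Real.rpow_nonneg (abs_nonneg _) _
    have hc : 0 < min (c₀ D) (c₁ D) := lt_min (hc₀ D) (hc₁ D)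
    have hbound := h.ae_norm_le hp hLj hT h₀ hc hE fun j hj ϑ ϑ' h1 h2 h3 h4 ξ₀ ξ₁ => by
      fin_cases j
      · exact (mul_le_mul_of_nonneg_right (min_le_left _ _) (by positivity)).trans
          (hcoer₀ D ϑ ϑ' h1 h2 h3 h4 ξ₀ ξ₁)
      · exact (mul_le_mul_of_nonneg_right (min_le_right _ _) (by positivity)).trans
          (hcoer₁ D ϑ ϑ' h1 h2 h3 h4 ξ₀ ξ₁)
      · exact absurd rfl hj
    have hnn : 0 ≤ 8 * (p * D) / min (c₀ D) (c₁ D) := by positivity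
    beta_reduce
    rw [two_mul, ENNReal.ofReal_add hnn hnn, eLpNorm_exponent_top, eLpNorm_exponent_top]
    exact add_le_add (eLpNormEssSup_le_of_ae_bound (hbound.mono fun t ht => ht.1))
      (eLpNormEssSup_le_of_ae_bound (hbound.mono fun t ht => ht.2))
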